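/- For a finite abelian group $G$ and $A \subseteq G$, let $\mathrm{ST}(A) = |\{(x,y,z) \in A^3 : x+y=z\}|$ be the number of Schur triples in $A$; $A$ is called sum-free if $\mathrm{ST}(A)=0$. Say that $G$ is of type $\mathrm{I}(p)$ if $p$ is the smallest prime factor of $|G|$ among those satisfying $p \equiv 2 \pmod 3$. There is an absolute constant $\delta > 0$ such that the following holds. Let $G$ be a finite abelian group of type $\mathrm{I}(p)$, where $p = 3k+2$. (a) If $0 \le t \le \delta |G|/p$, then every $A \subseteq G$ with $|A| = \left(\frac13 + \frac1{3p}\right)|G| + t$ satisfies $$\mathrm{ST}(A) \ge \frac{3t|G|}{p} + \mathbb{1}[p \neq 2] \cdot t^2 .$$ (b) If equality holds in (a), then there are a surjective homomorphism $\varphi \colon G \to \mathbb{Z}_p$ and a sum-free set $A' \subseteq \varphi^{-1}(\{k\})$ with $|A'| = t$ such that $A = \varphi^{-1}(\{k+1, \ldots, 2k+1\}) \cup A'$. (c) Conversely, surjective homomorphisms $\varphi \colon G \to \mathbb{Z}_p$ exist. For each of them, $A_0 = \varphi^{-1}(\{k+1, \ldots, 2k+1\})$ is a sum-free set with $\left(\frac13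 + \frac1{3p}\right)|G|$ elements; for every integer $t$ with $0 \le t \le 2|G|/(7p)$ there is a sum-free set $A' \subseteq \varphi^{-1}(\{k\})$ with $t$ elements; and for every sum-free set $A' \subseteq \varphi^{-1}(\{k\})$, with $t = |A'|$, we have $|A_0 \cup A'| = \left(\frac13 + \frac1{3p}\right)|G| + t$ and $$\mathrm{ST}(A_0 \cup A') = \frac{3t|G|}{p} + \mathbb{1}[p \neq 2] \cdot t^2 .$$ -/

import Mathlib

universe u

namespace SchurTriples

/-- The finite abelian group `G` is of type `I(p)`: `p` is the smallest prime factor of the order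
of `G` among those congruent to `2` modulo `3`. -/
def IsTypeI (p : ℕ) (G : Type u) [Fintype G] : Prop :=
  IsLeast {q : ℕ | q.Prime ∧ q ∣ Fintype.card G ∧ q % 3 = 2} p

/-- The number of (ordered) Schur triples `(x, y, z)`, `x + y = z`, with all entries in `A`. -/
def ST {G : Type u} [AddCommGroup G] [DecidableEq G] (A : Finset G) : ℕ :=
  ((A ×ˢ A ×ˢ A).filter fun w : G × G × G => w.1 + w.2.1 = w.2.2).card

/-- `A` contains no Schur triple. -/
def IsSumFree {G : Type u} [AddCommGroup G] (A : Finset G) : Prop :=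
  ∀ x ∈ A, ∀ y ∈ A, ∀ z ∈ A, x + y ≠ z

/-- The interval `{k + 1, …, 2 k + 1}` in `ℤ/p`. -/
def middleInterval (p k : ℕ) : Finset (ZMod p) :=
  (Finset.Icc (k + 1) (2 * k + 1)).image fun j : ℕ => (j : ZMod p)

/-- The preimage of `{k + 1, …, 2 k + 1}` under `φ : G → ℤ/p`. -/
def middlePreimage {G : Type u} [AddCommGroup G] [Fintype G] {p : ℕ} (k : ℕ)
    (φ : G →+ ZMod p) : Finset G :=
  Finset.univ.filter fun x => φ x ∈ middleInterval p k

/-- The fibre of `φ : G → ℤ/p` over the residue class of `k`. -/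
def fibre {G : Type u} [AddCommGroup G] [Fintype G] {p : ℕ} (k : ℕ)
    (φ : G →+ ZMod p) : Finset G :=
  Finset.univ.filter fun x => φ x = (k : ZMod p)

end SchurTriples

/-! Write `w = |G|/p`, so that `|A| = (k + 1) * w + s`. The proof is a stability argument. Suppose
`A` has no more Schur triples than claimed. Discard every `x ∈ A` with `3 * #{y ∈ A : x + y ∈ A} ≥
w`. By double counting at most `12 * s` elements go, and the rest `S` is sum-free: if `x + y = z` in
`S`, the sets `A`, `y + A`, `z + A` overlap pairwise in fewer than `w / 3` elements, so their union
would exceed `G`.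

A sum-free set of density above `1/3` is rigid (`IsSumFree.exists_quotient`). Either `|S + S| ≥ 2|S|
- 1`, and disjointness of `S` and `S + S` forces `3|S| = |G| + 1`, or Mann's theorem yields a
nontrivial subgroup modulo which `S` stays sum-free with no loss of density, and one recurses. The
final quotient has order `2` mod `3`. As `S` is nearly of density `1/3 + 1/(3p)`, this order must be
a prime `q ≥ p`. Cauchy–Davenport and Vosper's theorem make the image of `S` lie in a dilate of the
middle interval (`IsSumFree.exists_dilate`).

Thus `A` is close to `A₀ = φ⁻¹{j + 1, …, 2j + 1}` for some `φ : G → ℤ/q`, `q = 3j + 2`. Each element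
of `A \ A₀` creates about `3|G|/q` triples with `A₀`, and about twice as many unless it lies over
`±j`; pairs of new elements over `±j` supply the quadratic term. These gains beat the losses from
`A₀ \ A`, which gives the bound and the equality case (`ST_ge_of_close`). If `|G|/q < w`, then `A₀`
is smaller, `A` has a larger excess over it, and the bound obtained is strictly stronger than
needed. -/

namespace SchurTriples

/-! ### Mann's theorem and the rigidity of dense sum-free sets -/

section Isoperimetric

open Finset
open scoped Pointwise

variable {G : Type u} [AddCommGroup G] [DecidableEq G]

/-- A set minimizing `#(X + Y) - #Y`, and of least size among the minimizers, is a block of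
imprimitivity for translations. -/
lemma vadd_eq_of_isAtom [Fintype G] {X Y : Finset G} (hXY : X + Y ≠ univ)
    (hmin : ∀ Z : Finset G, Z.Nonempty → X + Z ≠ univ → #(X + Y) + #Z ≤ #(X + Z) + #Y)
    (hcard : ∀ Z : Finset G, Z.Nonempty → X + Z ≠ univ → #(X + Z) + #Y ≤ #(X + Y) + #Z →
      #Y ≤ #Z) (g : G) (hg : (Y ∩ (g +ᵥ Y)).Nonempty) : g +ᵥ Y = Y := by
  have hYg : #(g +ᵥ Y) = #Y := card_vadd_finset g Y
  have hXYg : #(X + (g +ᵥ Y)) = #(X + Y) := by rw [add_vadd_comm, card_vadd_finset]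
  have hui : #(Y ∪ (g +ᵥ Y)) + #(Y ∩ (g +ᵥ Y)) = #Y + #Y := by
    rw [card_union_add_card_inter, hYg]
  -- Submodularity of `Z ↦ #(X + Z)`: if the union is admissible, the intersection is again a
  -- minimizer.
  have hsub : #(X + (Y ∪ (g +ᵥ Y))) + #(X + (Y ∩ (g +ᵥ Y))) ≤ #(X + Y) + #(X + Y) := by
    calc _ ≤ #((X + Y) ∪ (X + (g +ᵥ Y))) + #((X + Y) ∩ (X + (g +ᵥ Y))) := by
          rw [add_union]
          gcongr
          exact add_inter_subset
      _ = _ := by rw [card_union_add_card_inter, hXYg]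
  have hne : X + (Y ∩ (g +ᵥ Y)) ≠ univ := fun h ↦ hXY <| by
    rw [eq_univ_iff_forall] at h ⊢
    exact fun a ↦ add_subset_add_left inter_subset_left (h a)
  have hle : #Y ≤ #(Y ∩ (g +ᵥ Y)) := by
    apply hcard _ hg hne
    by_cases hu : X + (Y ∪ (g +ᵥ Y)) = univ
    -- When the union is not admissible, duality helps: `-(X + Y)ᶜ` is a minimizer too, hence at
    -- least as large as `Y`.
    · have hdual : #Y ≤ #(-(X + Y)ᶜ) := by
        have hd : X + -(X + Y)ᶜ ⊆ (-Y)ᶜ := by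
          intro a ha
          obtain ⟨x, hx, c, hc, rfl⟩ := mem_add.1 ha
          rw [mem_neg'] at hc
          rw [mem_compl] at hc ⊢
          intro hy
          rw [mem_neg'] at hy
          apply hc
          rw [mem_add]
          exact ⟨x, hx, _, hy, by abel⟩
        have hYne : Y.Nonempty := hg.mono inter_subset_left
        have hd' : #(X + -(X + Y)ᶜ) + #Y ≤ Fintype.card G := by
          have := card_le_card hd
          rw [card_compl, card_neg] at this
          have := card_le_univ Y
          omega
        have hc : #(-(X + Y)ᶜ) = Fintype.card G - #(X + Y) := by
          rw [card_neg, card_compl]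
        have := card_le_univ (X + Y)
        apply hcard
        · rw [neg_nonempty_iff, nonempty_iff_ne_empty, Ne, compl_eq_empty_iff]
          exact hXY
        · intro h
          rw [h, card_univ] at hd'
          have := hYne.card_pos
          omega
        · omega
      rw [card_neg, card_compl] at hdual
      rw [hu, card_univ] at hsub
      have := card_le_univ (X + Y)
      omega
    · have := hmin _ ((hg.mono inter_subset_left).mono subset_union_left) hu
      omega
  have h1 := eq_of_subset_of_card_le inter_subset_left hle
  exact (eq_of_subset_of_card_le (inter_eq_left.1 h1) hYg.le).symm

/-- **Mann's theorem**: small sumsets with `X` are witnessed by subgroups. -/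
lemma exists_addSubgroup_of_card_add_lt [Fintype G] {X Y : Finset G} (hY : Y.Nonempty)
    (hXY : X + Y ≠ univ) (h : #(X + Y) + 1 < #X + #Y) :
    ∃ (H : AddSubgroup G) (K : Finset G), (∀ x, x ∈ K ↔ x ∈ H) ∧ X + K ≠ univ ∧
      #(X + K) + 1 < #X + #K := by
  obtain ⟨Y₀, hY₀, hmin⟩ := exists_min_image
    (univ.filter fun Z : Finset G ↦ Z.Nonempty ∧ X + Z ≠ univ)
    (fun Z ↦ (#(X + Z) : ℤ) - #Z) ⟨Y, by simp [hY, hXY]⟩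
  obtain ⟨Y₁, hY₁, hcard⟩ := exists_min_image
    (univ.filter fun Z : Finset G ↦ Z.Nonempty ∧ X + Z ≠ univ ∧
      (#(X + Z) : ℤ) - #Z ≤ #(X + Y₀) - #Y₀) card ⟨Y₀, by simpa using hY₀⟩
  simp only [mem_filter, mem_univ, true_and] at hY₀ hmin hY₁ hcard
  obtain ⟨⟨y, hy⟩, hne, hle⟩ := hY₁
  have hblock := vadd_eq_of_isAtom hne
    (fun Z hZ hZX ↦ by have := hmin Z ⟨hZ, hZX⟩; omega)
    (fun Z hZ hZX hZle ↦ hcard Z ⟨hZ, hZX, by omega⟩)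
  have key : ∀ a ∈ Y₁, ∀ b ∈ Y₁, (a - b) +ᵥ Y₁ = Y₁ := fun a ha b hb ↦
    hblock _ ⟨a, mem_inter.2 ⟨ha, mem_vadd_finset.2 ⟨b, hb, by simp⟩⟩⟩
  have hmem : ∀ x, x ∈ -y +ᵥ Y₁ ↔ y + x ∈ Y₁ := fun x ↦ by
    rw [mem_vadd_finset]
    constructor
    · rintro ⟨a, ha, rfl⟩
      simpa using ha
    · exact fun hx ↦ ⟨_, hx, by simp⟩
  -- A block through `0` is a subgroup: `Y₁` is fixed by all differences of its elements.
  let H : AddSubgroup G := AddSubgroup.ofSub (-y +ᵥ Y₁ : Finset G) ⟨0, by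
    rw [mem_coe, hmem]; simpa using hy⟩ (by
    intro a ha b hb
    rw [mem_coe, hmem] at ha hb ⊢
    have := key _ ha _ hb
    rw [← this]
    exact mem_vadd_finset.2 ⟨y, hy, by simp; abel⟩)
  refine ⟨H, -y +ᵥ Y₁, fun x ↦ Iff.rfl, ?_, ?_⟩
  · rw [add_vadd_comm]
    intro h'
    apply hne
    rw [← card_eq_iff_eq_univ] at h' ⊢
    rwa [card_vadd_finset] at h'
  · rw [add_vadd_comm, card_vadd_finset, card_vadd_finset]
    have := hmin Y ⟨hY, hXY⟩
    omega

/-- The reflection `u ↦ z - u` sends the coset of `y` to that of `x`, and sum-freeness makes the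
image of the trace of `S` miss `S`. -/
lemma IsSumFree.card_inter_add_card_inter_le {S K : Finset G} {H : AddSubgroup G}
    (hK : ∀ x, x ∈ K ↔ x ∈ H) (hS : IsSumFree S) {x y z : G} (hz : z ∈ S)
    (hxyz : z - x - y ∈ H) : #(S ∩ (x +ᵥ K)) + #(S ∩ (y +ᵥ K)) ≤ #K := by
  have hmem : ∀ a u, u ∈ a +ᵥ K ↔ u - a ∈ H := fun a u ↦ by
    rw [mem_vadd_finset, ← hK]
    constructor
    · rintro ⟨b, hb, rfl⟩
      simpa using hb
    · exact fun h ↦ ⟨_, h, by simp⟩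
  have hinj : Function.Injective fun u : G ↦ z - u := sub_right_injective
  rw [← card_vadd_finset x K, ← card_image_of_injective (S ∩ (y +ᵥ K)) hinj,
    ← card_union_of_disjoint]
  · apply card_le_card
    apply union_subset inter_subset_right
    intro v hv
    obtain ⟨u, hu, rfl⟩ := mem_image.1 hv
    rw [mem_inter, hmem] at hu
    rw [hmem]
    have := H.sub_mem hxyz hu.2
    convert this using 1
    abel
  · rw [disjoint_left]
    intro v hv hv'
    obtain ⟨u, hu, rfl⟩ := mem_image.1 hv'
    exact hS u (mem_inter.1 hu).1 _ (mem_inter.1 hv).1 z hz (by abel)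

/-- The same pigeonhole, with the translation by `y ∈ S` in place of a reflection. -/
lemma IsSumFree.card_inter_add_card_inter_le' {S K : Finset G} {H : AddSubgroup G}
    (hK : ∀ x, x ∈ K ↔ x ∈ H) (hS : IsSumFree S) {x y z : G} (hy : y ∈ S)
    (hxyz : z - x - y ∈ H) : #(S ∩ (x +ᵥ K)) + #(S ∩ (z +ᵥ K)) ≤ #K := by
  have hmem : ∀ a u, u ∈ a +ᵥ K ↔ u - a ∈ H := fun a u ↦ by
    rw [mem_vadd_finset, ← hK]
    constructor
    · rintro ⟨b, hb, rfl⟩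
      simpa using hb
    · exact fun h ↦ ⟨_, h, by simp⟩
  have hinj : Function.Injective fun u : G ↦ u + y := add_left_injective y
  rw [← card_vadd_finset z K, ← card_image_of_injective (S ∩ (x +ᵥ K)) hinj,
    ← card_union_of_disjoint]
  · apply card_le_card
    apply union_subset _ inter_subset_right
    intro v hv
    obtain ⟨u, hu, rfl⟩ := mem_image.1 hv
    rw [mem_inter, hmem] at hu
    rw [hmem]
    have := H.sub_mem hu.2 hxyz
    convert this using 1
    abel
  · rw [disjoint_left]
    intro v hv' hv
    obtain ⟨u, hu, rfl⟩ := mem_image.1 hv'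
    exact hS u (mem_inter.1 hu).1 _ hy _ (mem_inter.1 hv).1 rfl

/-- `S + K` has at most `#K - 2` elements outside `S`, so two distinct cosets meeting `S` cannot
together miss `#K` elements of `S`. -/
lemma card_lt_card_inter_add_card_inter {S K : Finset G} {H : AddSubgroup G}
    (hK : ∀ x, x ∈ K ↔ x ∈ H) (hlt : #(S + K) + 1 < #S + #K) {x y : G} (hx : x ∈ S) (hy : y ∈ S)
    (hxy : x - y ∉ H) : #K < #(S ∩ (x +ᵥ K)) + #(S ∩ (y +ᵥ K)) := by
  have hmem : ∀ a u, u ∈ a +ᵥ K ↔ u - a ∈ H := fun a u ↦ by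
    rw [mem_vadd_finset, ← hK]
    constructor
    · rintro ⟨b, hb, rfl⟩
      simpa using hb
    · exact fun h ↦ ⟨_, h, by simp⟩
  have hdisj : Disjoint (x +ᵥ K) (y +ᵥ K) := by
    rw [disjoint_left]
    intro u hu hu'
    rw [hmem] at hu hu'
    apply hxy
    have := H.sub_mem hu' hu
    convert this using 1
    abel
  have hsub : ∀ a ∈ S, a +ᵥ K ⊆ S + K := fun a ha u hu ↦ by
    obtain ⟨b, hb, rfl⟩ := mem_vadd_finset.1 hu
    exact add_mem_add ha hb
  have hSK : S ⊆ S + K := fun a ha ↦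
    mem_add.2 ⟨a, ha, 0, (hK 0).2 H.zero_mem, by simp⟩
  have h1 : #((x +ᵥ K) \ S) + #((y +ᵥ K) \ S) ≤ #((S + K) \ S) := by
    rw [← card_union_of_disjoint (hdisj.mono sdiff_subset sdiff_subset)]
    apply card_le_card
    rw [← union_sdiff_distrib]
    exact sdiff_subset_sdiff (union_subset (hsub x hx) (hsub y hy)) le_rfl
  have h2 := card_sdiff_add_card_eq_card hSK
  have h3 := card_inter_add_card_sdiff (x +ᵥ K) S
  have h4 := card_inter_add_card_sdiff (y +ᵥ K) S
  rw [card_vadd_finset, inter_comm] at h3 h4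
  omega

/-- Makes the image of `S` modulo `H` sum-free. A Schur triple of cosets bounds pairs of traces by
`#K`, whereas distinct cosets have traces of total size above `#K`. So all three cosets coincide,
hence equal `H`, and then `S ⊆ H`; this gives `2 * #S ≤ #K ≤ |G| / 2`, against the density of `S`.
-/
lemma IsSumFree.image_quotient [Fintype G] {S K : Finset G} {H : AddSubgroup G}
    (hK : ∀ x, x ∈ K ↔ x ∈ H) (hS : IsSumFree S) (hcard : Fintype.card G < 3 * #S)
    (hne : S + K ≠ univ) (hlt : #(S + K) + 1 < #S + #K) {x y z : G} (hx : x ∈ S) (hy : y ∈ S)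
    (hz : z ∈ S) : z - x - y ∉ H := by
  intro h
  have hxy : x - y ∈ H := by
    by_contra hxy
    have h1 := card_lt_card_inter_add_card_inter hK hlt hx hy hxy
    have h2 := hS.card_inter_add_card_inter_le hK hz h
    omega
  have hxz : x - z ∈ H := by
    by_contra hxz
    have h1 := card_lt_card_inter_add_card_inter hK hlt hx hz hxz
    have h2 := hS.card_inter_add_card_inter_le' hK hy h
    omega
  have hyH : y ∈ H := by
    have := H.neg_mem (H.add_mem h hxz)
    convert this using 1
    abel
  have hxH : x ∈ H := by
    have := H.add_mem hxy hyH
    convert this using 1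
    abel
  have hSH : S ⊆ K := by
    intro a ha
    by_contra haK
    have hxa : x - a ∉ H := fun hxa ↦ haK <| (hK a).2 <| by
      have := H.sub_mem hxH hxa
      convert this using 1
      abel
    have h1 := card_lt_card_inter_add_card_inter hK hlt hx ha hxa
    have h2 := hS.card_inter_add_card_inter_le hK (x := x) ha (y := a)
      (by simpa using hxH)
    omega
  have hxK : x +ᵥ K = K := by
    ext u
    rw [mem_vadd_finset, hK]
    constructor
    · rintro ⟨b, hb, rfl⟩
      exact H.add_mem hxH ((hK b).1 hb)
    · exact fun hu ↦ ⟨u - x, (hK _).2 (H.sub_mem hu hxH), by simp⟩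
  have hyK : y +ᵥ K = K := by
    ext u
    rw [mem_vadd_finset, hK]
    constructor
    · rintro ⟨b, hb, rfl⟩
      exact H.add_mem hyH ((hK b).1 hb)
    · exact fun hu ↦ ⟨u - y, (hK _).2 (H.sub_mem hu hyH), by simp⟩
  have h2 := hS.card_inter_add_card_inter_le hK hz h
  rw [hxK, hyK, inter_eq_left.2 hSH] at h2
  obtain ⟨g, hg⟩ : ∃ g, g ∉ K := by
    by_contra! hall
    apply hne
    rw [eq_univ_iff_forall]
    exact fun a ↦ mem_add.2 ⟨x, hx, a - x, hall _, by abel⟩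
  have hdisj : Disjoint (g +ᵥ K) K := by
    rw [disjoint_left]
    intro u hu hu'
    obtain ⟨b, hb, rfl⟩ := mem_vadd_finset.1 hu
    apply hg
    rw [hK] at hu' hb ⊢
    have := H.sub_mem hu' hb
    simpa using this
  have h3 := card_le_univ ((g +ᵥ K) ∪ K)
  rw [card_union_of_disjoint hdisj, card_vadd_finset] at h3
  omega

/-- A sum-free set with more than a third of the elements is contained in the preimage of a
sum-free set `X` with `3 * #X = |Q| + 1` in some quotient `Q`. -/
theorem IsSumFree.exists_quotient (n : ℕ) : ∀ (G : Type u) [AddCommGroup G] [Fintype G]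
    (S : Finset G), Fintype.card G = n → IsSumFree S → Fintype.card G < 3 * #S →
    ∃ (Q : Type u) (_ : AddCommGroup Q) (_ : Fintype Q) (π : G →+ Q) (X : Finset Q),
      Function.Surjective π ∧ IsSumFree X ∧ 3 * #X = Fintype.card Q + 1 ∧ ∀ s ∈ S, π s ∈ X := by
  induction n using Nat.strong_induction_on with
  | _ n ih =>
  intro G _ _ S hn hS hcard
  classical
  have hdisj : Disjoint (S + S) S := by
    rw [disjoint_left]
    intro a ha ha'
    obtain ⟨x, hx, y, hy, hxy⟩ := mem_add.1 ha
    exact hS x hx y hy a ha' hxy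
  have hle := card_le_univ ((S + S) ∪ S)
  rw [card_union_of_disjoint hdisj] at hle
  have hne : S.Nonempty := by
    rw [← card_pos]
    omega
  by_cases hsmall : #(S + S) + 1 < #S + #S
  · have hSS : S + S ≠ univ := fun h ↦ by
      rw [h, card_univ] at hle
      have := hne.card_pos
      omega
    obtain ⟨H, K, hK, hSK, hlt⟩ := exists_addSubgroup_of_card_add_lt hne hSS hsmall
    have hfree : IsSumFree (S.image (QuotientAddGroup.mk' H)) := by
      intro a ha b hb c hc habc
      obtain ⟨x, hx, rfl⟩ := mem_image.1 ha
      obtain ⟨y, hy, rfl⟩ := mem_image.1 hb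
      obtain ⟨z, hz, rfl⟩ := mem_image.1 hc
      apply hS.image_quotient hK hcard hSK hlt hx hy hz
      rw [← map_add] at habc
      have := QuotientAddGroup.eq.1 habc
      convert this using 1
      abel
    have hKH : Nat.card H = #K := by
      rw [Nat.card_eq_fintype_card, Fintype.card_subtype]
      congr 1
      ext x
      simp [hK]
    have hprod : Fintype.card G = Fintype.card (G ⧸ H) * #K := by
      rw [← hKH, ← Nat.card_eq_fintype_card, ← Nat.card_eq_fintype_card,
        AddSubgroup.card_eq_card_quotient_mul_card_addSubgroup H]
    have hfib : #S ≤ #K * #(S.image (QuotientAddGroup.mk' H)) := by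
      apply card_le_mul_card_image
      intro b hb
      obtain ⟨x, hx, rfl⟩ := mem_image.1 hb
      rw [← card_vadd_finset x K]
      apply card_le_card
      intro y hy
      rw [mem_filter] at hy
      have := QuotientAddGroup.eq.1 hy.2.symm
      exact mem_vadd_finset.2 ⟨-x + y, (hK _).2 this, by simp⟩
    have hK1 : 1 < #K := by
      have : #S ≤ #(S + K) := card_le_card fun a ha ↦
        mem_add.2 ⟨a, ha, 0, (hK 0).2 H.zero_mem, by simp⟩
      omega
    have hQ : Fintype.card (G ⧸ H) < n := by
      have : 0 < Fintype.card (G ⧸ H) := Fintype.card_pos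
      nlinarith
    have hQS : Fintype.card (G ⧸ H) < 3 * #(S.image (QuotientAddGroup.mk' H)) := by
      by_contra! hcon
      have := Nat.mul_le_mul_right #K hcon
      nlinarith
    obtain ⟨Q, iQ, jQ, π, X, hπ, hX, hXc, hSX⟩ := ih _ hQ (G ⧸ H) _ rfl hfree hQS
    refine ⟨Q, iQ, jQ, π.comp (QuotientAddGroup.mk' H), X, ?_, hX, hXc, fun s hs ↦ ?_⟩
    · exact hπ.comp (QuotientAddGroup.mk'_surjective H)
    · exact hSX _ (mem_image_of_mem _ hs)
  -- Here `3 * #S - 1 ≤ #(S + S) + #S ≤ |G| < 3 * #S`, so `G` itself is the quotient.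
  · exact ⟨G, inferInstance, inferInstance, AddMonoidHom.id G, S, Function.surjective_id, hS,
      by omega, fun s hs ↦ hs⟩

end Isoperimetric

/-! ### Vosper's theorem and maximum sum-free sets in `ℤ/p` -/

section Vosper

open Finset
open scoped Pointwise

lemma mem_middleInterval {p k : ℕ} [NeZero p] (h : 2 * k + 1 < p) (x : ZMod p) :
    x ∈ middleInterval p k ↔ k + 1 ≤ x.val ∧ x.val ≤ 2 * k + 1 := by
  rw [middleInterval, mem_image]
  constructor
  · rintro ⟨j, hj, rfl⟩
    rw [mem_Icc] at hj
    rwa [ZMod.val_natCast_of_lt (by omega)]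
  · exact fun hx ↦ ⟨x.val, mem_Icc.2 hx, ZMod.natCast_zmod_val x⟩

variable {p : ℕ} [Fact p.Prime]

/-- Dyson's transform yields a strictly smaller second set, unless that set is a pair. -/
lemma exists_card_inter_lt {A B : Finset (ZMod p)} (hA : 2 ≤ #A) (hB : 3 ≤ #B)
    (hAB : #(A + B) + 1 = #A + #B) (hp : #(A + B) + 2 ≤ p) :
    ∃ g : ZMod p, 2 ≤ #(B ∩ (-g +ᵥ A)) ∧ #(B ∩ (-g +ᵥ A)) < #B := by
  obtain ⟨b, hb⟩ : B.Nonempty := card_pos.1 (by omega)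
  by_contra! hcon
  -- For `e ∈ E` the intersection at `g = e - b` contains `b` but is not all of `B`, so under `hcon`
  -- it is `{b}`. Then `E + (B \ {b})` avoids `b + A` and lies in a set of size `#B - 1`, too small
  -- once `#E ≥ 2`.
  set E := A.filter fun e ↦ ¬ (B ⊆ -(e - b) +ᵥ A) with hE
  have hmem : ∀ g u : ZMod p, u ∈ -g +ᵥ A ↔ g + u ∈ A := fun g u ↦ by
    rw [mem_vadd_finset]
    constructor
    · rintro ⟨a, ha, rfl⟩
      simpa using ha
    · exact fun h ↦ ⟨_, h, by simp⟩
  have hE2 : 2 ≤ #E := by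
    by_cases hY : (A \ E).Nonempty
    · have hsub : (A \ E) + (-b +ᵥ B) ⊆ A := by
        intro u hu
        obtain ⟨e, he, c, hc, rfl⟩ := mem_add.1 hu
        obtain ⟨b', hb', rfl⟩ := mem_vadd_finset.1 hc
        rw [mem_sdiff, hE, mem_filter, not_and, not_not] at he
        have := (hmem _ _).1 (he.2 he.1 hb')
        convert this using 1
        simp only [vadd_eq_add]
        abel
      have h1 := card_le_card hsub
      have h2 := ZMod.cauchy_davenport Fact.out hY (t := -b +ᵥ B) ⟨0, mem_vadd_finset.2 ⟨b, hb, by simp⟩⟩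
      rw [card_vadd_finset] at h2
      have h3 := card_sdiff_add_card_eq_card (filter_subset (fun e ↦ ¬ (B ⊆ -(e - b) +ᵥ A)) A)
      rw [← hE] at h3
      rcases min_le_iff.1 h2 with h | h <;> omega
    · rw [not_nonempty_iff_eq_empty, sdiff_eq_empty_iff_subset] at hY
      exact hA.trans (card_le_card hY)
  have hsub : E + B.erase b ⊆ (A + B) \ (b +ᵥ A) := by
    intro u hu
    obtain ⟨e, he, c, hc, rfl⟩ := mem_add.1 hu
    rw [mem_erase] at hc
    rw [hE, mem_filter] at he
    refine mem_sdiff.2 ⟨add_mem_add he.1 hc.2, fun h ↦ ?_⟩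
    obtain ⟨a, ha, hab⟩ := mem_vadd_finset.1 h
    apply he.2
    have h2 : 2 ≤ #(B ∩ (-(e - b) +ᵥ A)) := by
      rw [← card_pair hc.1]
      apply card_le_card
      rw [insert_subset_iff, singleton_subset_iff, mem_inter, mem_inter, hmem, hmem]
      refine ⟨⟨hc.2, ?_⟩, hb, by simpa using he.1⟩
      convert ha using 1
      rw [vadd_eq_add] at hab
      linear_combination -hab
    exact inter_eq_left.1 (eq_of_subset_of_card_le inter_subset_left (hcon _ h2))
  have h1 := card_le_card hsub
  have h2 := ZMod.cauchy_davenport Fact.out (s := E) (t := B.erase b) (card_pos.1 (by omega))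
    (card_pos.1 (by rw [card_erase_of_mem hb]; omega))
  have h3 := card_sdiff_add_card_eq_card (show b +ᵥ A ⊆ A + B from fun u hu ↦ by
    obtain ⟨a, ha, rfl⟩ := mem_vadd_finset.1 hu
    rw [vadd_eq_add, add_comm b]
    exact add_mem_add ha hb)
  rw [card_vadd_finset] at h3
  rw [card_erase_of_mem hb] at h2
  rcases min_le_iff.1 h2 with h | h <;> omega

/-- **Vosper's theorem**, for the sumset: a critical sumset is an arithmetic progression. -/
lemma exists_card_vadd_sdiff_le_one (n : ℕ) : ∀ A B : Finset (ZMod p), #B = n → 2 ≤ #A →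
    2 ≤ #B → #(A + B) + 1 = #A + #B → #(A + B) + 2 ≤ p →
    ∃ d : ZMod p, d ≠ 0 ∧ #((d +ᵥ (A + B)) \ (A + B)) ≤ 1 := by
  induction n using Nat.strong_induction_on with
  | _ n ih =>
  intro A B hn hA hB hAB hp
  rcases hB.eq_or_lt with h2 | h3
  · obtain ⟨b, c, hbc, rfl⟩ := card_eq_two.1 h2.symm
    refine ⟨c - b, sub_ne_zero.2 hbc.symm, ?_⟩
    have hC : A + {b, c} = (b +ᵥ A) ∪ (c +ᵥ A) := by
      ext u
      simp only [mem_add, mem_union, mem_vadd_finset, mem_insert, mem_singleton, vadd_eq_add]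
      constructor
      · rintro ⟨a, ha, y, rfl | rfl, rfl⟩
        · exact Or.inl ⟨a, ha, add_comm _ _⟩
        · exact Or.inr ⟨a, ha, add_comm _ _⟩
      · rintro (⟨a, ha, rfl⟩ | ⟨a, ha, rfl⟩)
        · exact ⟨a, ha, b, Or.inl rfl, add_comm _ _⟩
        · exact ⟨a, ha, c, Or.inr rfl, add_comm _ _⟩
    have hsub : ((c - b) +ᵥ (A + {b, c})) \ (A + {b, c}) ⊆
        (c - b) +ᵥ ((A + {b, c}) \ (b +ᵥ A)) := by
      intro u hu
      rw [mem_sdiff] at hu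
      obtain ⟨v, hv, rfl⟩ := mem_vadd_finset.1 hu.1
      refine mem_vadd_finset.2 ⟨v, mem_sdiff.2 ⟨hv, fun hv' ↦ hu.2 ?_⟩, rfl⟩
      obtain ⟨a, ha, rfl⟩ := mem_vadd_finset.1 hv'
      rw [hC]
      refine mem_union_right _ (mem_vadd_finset.2 ⟨a, ha, ?_⟩)
      simp only [vadd_eq_add]
      ring
    refine (card_le_card hsub).trans ?_
    rw [card_vadd_finset]
    have := card_sdiff_add_card_eq_card (show b +ᵥ A ⊆ A + {b, c} by
      rw [hC]; exact subset_union_left)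
    rw [card_vadd_finset] at this
    omega
  · obtain ⟨g, hg2, hgB⟩ := exists_card_inter_lt hA h3 hAB hp
    have hsub := addDysonETransform.subset g (A, B)
    have hcard := addDysonETransform.card g (A, B)
    simp only [addDysonETransform] at hsub hcard
    have hA' : #A ≤ #(A ∪ (g +ᵥ B)) := card_le_card subset_union_left
    have hle := card_le_card hsub
    have hcd := ZMod.cauchy_davenport Fact.out (s := A ∪ (g +ᵥ B)) (t := B ∩ (-g +ᵥ A))
      (card_pos.1 (by omega)) (card_pos.1 (by omega))
    -- The transform preserves the total size and does not enlarge the sumset, so Cauchy–Davenport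
    -- forces equality. The induction therefore transports a property of `A + B` alone.
    have heq : A ∪ (g +ᵥ B) + B ∩ (-g +ᵥ A) = A + B := by
      apply eq_of_subset_of_card_le hsub
      rcases min_le_iff.1 hcd with h | h <;> omega
    have := ih _ (hn ▸ hgB) (A ∪ (g +ᵥ B)) (B ∩ (-g +ᵥ A)) rfl (by omega) hg2
      (by rw [heq]; omega) (by rw [heq]; omega)
    rwa [heq] at this

/-- Cauchy–Davenport gives `#(X + X) ≥ 2k + 1 = #Xᶜ`, so `X + X = Xᶜ` is critical. Vosper's theorem
applies to it, and passing to complements reverses the sign of the step. A singleton (`k = 0`) is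
treated apart. -/
lemma IsSumFree.exists_card_filter_le_one {k : ℕ} (hpk : p = 3 * k + 2) {X : Finset (ZMod p)}
    (hX : IsSumFree X) (hk : #X = k + 1) :
    ∃ d : ZMod p, d ≠ 0 ∧ #(X.filter fun x ↦ x + d ∉ X) ≤ 1 := by
  rcases Nat.eq_zero_or_pos k with rfl | hk0
  · exact ⟨1, one_ne_zero, (card_le_card (filter_subset _ _)).trans hk.le⟩
  have hne : X.Nonempty := card_pos.1 (by omega)
  have hsub : X + X ⊆ Xᶜ := by
    intro a ha
    obtain ⟨x, hx, y, hy, rfl⟩ := mem_add.1 ha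
    rw [mem_compl]
    exact fun h ↦ hX x hx y hy _ h rfl
  have hXc : #Xᶜ = 2 * k + 1 := by
    rw [card_compl, ZMod.card, hk]
    omega
  have hcd := ZMod.cauchy_davenport Fact.out hne hne
  have heq : X + X = Xᶜ := by
    apply eq_of_subset_of_card_le hsub
    rcases min_le_iff.1 hcd with h | h <;> omega
  obtain ⟨d, hd, hd1⟩ := exists_card_vadd_sdiff_le_one _ X X rfl (by omega) (by omega)
    (by rw [heq]; omega) (by rw [heq]; omega)
  refine ⟨-d, neg_ne_zero.2 hd, (card_le_card fun x hx ↦ ?_).trans hd1⟩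
  rw [mem_filter] at hx
  rw [heq, mem_sdiff, mem_compl, not_not]
  refine ⟨mem_vadd_finset.2 ⟨x + -d, mem_compl.2 hx.2, ?_⟩, hx.1⟩
  simp

/-- A nonempty proper subset of `ℤ/p` with at most one element not followed by another one is an
interval. -/
lemma exists_interval_of_card_filter_le_one {k : ℕ} {X : Finset (ZMod p)} (hk : #X = k + 1)
    (hkp : k + 1 < p) (h1 : #(X.filter fun x ↦ x + 1 ∉ X) ≤ 1) :
    ∃ a : ZMod p, ∀ x, x ∈ X ↔ ∃ j : ℕ, j ≤ k ∧ x = a + j := by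
  obtain ⟨b, hb, hb1⟩ : ∃ b ∈ X, b + 1 ∉ X := by
    by_contra! hcon
    obtain ⟨x, hx⟩ : X.Nonempty := card_pos.1 (by omega)
    have hall : ∀ n : ℕ, x + n ∈ X := fun n ↦ by
      induction n with
      | zero => simpa using hx
      | succ n ih => simpa [add_assoc] using hcon _ ih
    have : X = univ := by
      rw [eq_univ_iff_forall]
      intro y
      have := hall (y - x).val
      rwa [ZMod.natCast_zmod_val, add_sub_cancel] at this
    rw [this, card_univ, ZMod.card] at hk
    omega
  have huniq : ∀ y ∈ X, y + 1 ∉ X → y = b := fun y hy hy1 ↦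
    card_le_one.1 h1 y (mem_filter.2 ⟨hy, hy1⟩) b (mem_filter.2 ⟨hb, hb1⟩)
  set J := (range p).filter fun i : ℕ ↦ b - (i : ZMod p) ∈ X with hJ
  have hJX : J.image (fun i : ℕ ↦ b - (i : ZMod p)) = X := by
    ext x
    rw [mem_image]
    constructor
    · rintro ⟨i, hi, rfl⟩
      exact (mem_filter.1 hi).2
    · intro hx
      refine ⟨(b - x).val, mem_filter.2 ⟨mem_range.2 (ZMod.val_lt _), ?_⟩, ?_⟩ <;>
      simp [hx]
  have hJc : #J = k + 1 := by
    rw [← hk, ← hJX, card_image_of_injOn]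
    intro i hi j hj hij
    have hi' := mem_range.1 (mem_filter.1 hi).1
    have hj' := mem_range.1 (mem_filter.1 hj).1
    have : (i : ZMod p) = j := sub_right_injective hij
    rw [← ZMod.val_natCast_of_lt hi', ← ZMod.val_natCast_of_lt hj', this]
  -- Otherwise `b - (i + 1)` is a right endpoint, hence equals `b`, which is impossible for `0 < i +
  -- 1 < p`.
  have hdown : ∀ i, i + 1 ∈ J → i ∈ J := by
    intro i hi
    rw [hJ, mem_filter, mem_range] at hi ⊢
    refine ⟨by omega, ?_⟩
    by_contra hcon
    have := huniq _ hi.2 (by convert hcon using 1; push_cast; ring_nf)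
    have h0 : ((i + 1 : ℕ) : ZMod p) = 0 := by linear_combination -this
    rw [ZMod.natCast_eq_zero_iff] at h0
    exact absurd (Nat.le_of_dvd (by omega) h0) (by omega)
  have hlow : ∀ i j, i + j ∈ J → i ∈ J := fun i j ↦ by
    induction j with
    | zero => exact id
    | succ j ih => exact fun h ↦ ih (hdown _ h)
  have hJr : J = range (k + 1) := by
    apply eq_of_subset_of_card_le
    · intro i hi
      rw [mem_range, ← hJc, ← Nat.succ_le_iff, ← card_range i.succ]
      apply card_le_card
      intro j hj
      rw [mem_range] at hj
      apply hlow j (i - j)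
      rwa [Nat.add_sub_cancel' (by omega)]
    · rw [card_range, hJc]
  refine ⟨b - k, fun x ↦ ?_⟩
  rw [← hJX, hJr, mem_image]
  constructor
  · rintro ⟨i, hi, rfl⟩
    rw [mem_range] at hi
    refine ⟨k - i, by omega, ?_⟩
    rw [Nat.cast_sub (by omega)]
    ring
  · rintro ⟨j, hj, rfl⟩
    refine ⟨k - j, mem_range.2 (by omega), ?_⟩
    rw [Nat.cast_sub hj]
    ring

/-- Sum-free sets of maximum size in `ℤ/p`, where `p = 3 * k + 2`, are dilates of the middle
interval. -/
theorem IsSumFree.exists_dilate {k : ℕ} (hpk : p = 3 * k + 2) {X : Finset (ZMod p)}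
    (hX : IsSumFree X) (hk : #X = k + 1) :
    ∃ c : ZMod p, c ≠ 0 ∧ ∀ x ∈ X, c * x ∈ middleInterval p k := by
  obtain ⟨d, hd, hd1⟩ := hX.exists_card_filter_le_one hpk hk
  have hinj : Function.Injective fun x : ZMod p ↦ d⁻¹ * x :=
    mul_right_injective₀ (inv_ne_zero hd)
  have hmem : ∀ x, x ∈ X.image (fun x ↦ d⁻¹ * x) ↔ d * x ∈ X := fun x ↦ by
    rw [mem_image]
    constructor
    · rintro ⟨y, hy, rfl⟩
      rwa [mul_inv_cancel_left₀ hd]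
    · exact fun h ↦ ⟨_, h, inv_mul_cancel_left₀ hd x⟩
  obtain ⟨a, ha⟩ := exists_interval_of_card_filter_le_one (k := k)
    (X := X.image fun x ↦ d⁻¹ * x) (by rw [card_image_of_injective _ hinj, hk]) (by omega) (by
      rw [← card_image_of_injective _ (mul_right_injective₀ hd)]
      refine (card_le_card fun y hy ↦ ?_).trans hd1
      obtain ⟨x, hx, rfl⟩ := mem_image.1 hy
      rw [mem_filter, hmem, hmem] at hx
      rw [mem_filter]
      exact ⟨hx.1, by simpa [mul_add] using hx.2⟩)
  -- This is `(a + i) + (a + j) ≠ a + l` with one `a` cancelled: `a, …, a + 2k` misses `0, …, k`,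
  -- which leaves only `a = k + 1`.
  have hfree : ∀ i j l : ℕ, i ≤ k → j ≤ k → l ≤ k → a + (i + j : ℕ) ≠ l := by
    intro i j l hi hj hl h
    apply hX _ ((hmem _).1 ((ha _).2 ⟨i, hi, rfl⟩)) _ ((hmem _).1 ((ha _).2 ⟨j, hj, rfl⟩)) _
      ((hmem _).1 ((ha _).2 ⟨l, hl, rfl⟩))
    push_cast at h
    linear_combination d * h
  have hlow : k + 1 ≤ a.val := by
    by_contra! h
    exact hfree 0 0 a.val (by omega) (by omega) (by omega) (by simp)
  have hap := ZMod.val_lt a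
  have hup : a.val + 2 * k < p := by
    by_contra! h
    apply hfree (min k (p - a.val)) (p - a.val - min k (p - a.val)) 0 (by omega) (by omega)
      (by omega)
    rw [Nat.add_sub_cancel' (by omega), Nat.cast_sub hap.le]
    simp
  refine ⟨d⁻¹, inv_ne_zero hd, fun x hx ↦ ?_⟩
  obtain ⟨j, hj, hxj⟩ := (ha _).1 (mem_image_of_mem _ hx)
  rw [hxj]
  have : a + j = ((k + 1 + j : ℕ) : ZMod p) := by
    rw [← ZMod.natCast_zmod_val a, show a.val = k + 1 by omega]
    push_cast
    ring
  rw [this]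
  exact mem_image_of_mem _ (mem_Icc.2 ⟨by omega, by omega⟩)

end Vosper

/-! ### Counting triples with prescribed slots -/

section Counting

open Finset
open scoped Pointwise

variable {G : Type u} [AddCommGroup G] [DecidableEq G]

/-- The number of triples `(x, y, z) ∈ A × B × C` with `x + y = z`. -/
def tripleCount (A B C : Finset G) : ℕ :=
  ∑ x ∈ A, ∑ y ∈ B, if x + y ∈ C then 1 else 0

lemma tripleCount_eq_sum (A B C : Finset G) :
    tripleCount A B C = ∑ x ∈ A, ∑ y ∈ B, ∑ z ∈ C, if x + y = z then 1 else 0 := by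
  simp [tripleCount]

lemma ST_eq_tripleCount (A : Finset G) : ST A = tripleCount A A A := by
  rw [tripleCount_eq_sum, ST, card_filter, sum_product]
  exact sum_congr rfl fun x _ ↦ sum_product _ _ _

lemma tripleCount_eq_sum_card (A B C : Finset G) :
    tripleCount A B C = ∑ x ∈ A, #(B.filter fun y ↦ x + y ∈ C) := by
  simp only [tripleCount, card_filter]

lemma tripleCount_comm (A B C : Finset G) : tripleCount A B C = tripleCount B A C := by
  rw [tripleCount, sum_comm, tripleCount]
  simp only [add_comm]

/-- Rewrites `x + y = z` as `z + (-x) = y`; with commutativity it carries every statement about the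
first slot to the others. -/
lemma tripleCount_rotate (A B C : Finset G) : tripleCount A B C = tripleCount C (-A) B := by
  rw [tripleCount_eq_sum, tripleCount_eq_sum, sum_congr rfl fun x _ ↦ sum_comm, sum_comm]
  refine sum_congr rfl fun z _ ↦ ?_
  rw [← image_neg_eq_neg, sum_image neg_injective.injOn]
  refine sum_congr rfl fun x _ ↦ sum_congr rfl fun y _ ↦ if_congr ?_ rfl rfl
  rw [← sub_eq_add_neg, sub_eq_iff_eq_add, eq_comm, add_comm x y]

lemma tripleCount_union_left {A A' : Finset G} (h : Disjoint A A') (B C : Finset G) :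
    tripleCount (A ∪ A') B C = tripleCount A B C + tripleCount A' B C :=
  sum_union h

lemma tripleCount_union_mid {B B' : Finset G} (h : Disjoint B B') (A C : Finset G) :
    tripleCount A (B ∪ B') C = tripleCount A B C + tripleCount A B' C := by
  simp only [tripleCount_comm A, tripleCount_union_left h]

lemma tripleCount_union_right {C C' : Finset G} (h : Disjoint C C') (A B : Finset G) :
    tripleCount A B (C ∪ C') = tripleCount A B C + tripleCount A B C' := by
  simp only [tripleCount_rotate A B, tripleCount_union_left h]

lemma tripleCount_le_card_mul_card (A B C : Finset G) : tripleCount A B C ≤ #A * #B := by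
  rw [tripleCount_eq_sum_card]
  exact sum_le_card_nsmul _ _ _ fun x _ ↦ card_filter_le _ _

lemma tripleCount_le_card_mul_card_left (A B C : Finset G) :
    tripleCount A B C ≤ #A * #C := by
  rw [tripleCount_rotate, mul_comm, ← card_neg A]
  exact tripleCount_le_card_mul_card _ _ _

lemma tripleCount_le_card_mul_card_right (A B C : Finset G) :
    tripleCount A B C ≤ #B * #C := by
  rw [tripleCount_comm]
  exact tripleCount_le_card_mul_card_left _ _ _

lemma tripleCount_mono_left {A A' : Finset G} (h : A ⊆ A') (B C : Finset G) :
    tripleCount A B C ≤ tripleCount A' B C :=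
  sum_le_sum_of_subset h

lemma tripleCount_mono_mid {B B' : Finset G} (h : B ⊆ B') (A C : Finset G) :
    tripleCount A B C ≤ tripleCount A B' C := by
  simp only [tripleCount_comm A]
  exact tripleCount_mono_left h _ _

lemma tripleCount_mono_right {C C' : Finset G} (h : C ⊆ C') (A B : Finset G) :
    tripleCount A B C ≤ tripleCount A B C' := by
  simp only [tripleCount_rotate A B]
  exact tripleCount_mono_left h _ _

lemma tripleCount_eq_card_mul_card {A B C : Finset G} (h : ∀ x ∈ A, ∀ y ∈ B, x + y ∈ C) :
    tripleCount A B C = #A * #B := by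
  rw [tripleCount_eq_sum_card, ← smul_eq_mul, ← sum_const]
  exact sum_congr rfl fun x hx ↦ by rw [filter_true_of_mem (h x hx)]

lemma tripleCount_eq_card_mul_card_left {A B C : Finset G} (h : ∀ x ∈ A, ∀ z ∈ C, z - x ∈ B) :
    tripleCount A B C = #A * #C := by
  rw [tripleCount_rotate, tripleCount_eq_card_mul_card, card_neg, mul_comm]
  intro z hz x hx
  rw [mem_neg'] at hx
  simpa using h _ hx z hz

lemma tripleCount_eq_zero {A B C : Finset G} (h : ∀ x ∈ A, ∀ y ∈ B, x + y ∉ C) :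
    tripleCount A B C = 0 :=
  sum_eq_zero fun x hx ↦ sum_eq_zero fun y hy ↦ if_neg (h x hx y hy)

/-- The cost of deleting `M`: a triple using `M` in a given slot is determined by its entries in `E`
and `M`, and there are two such slots. -/
lemma tripleCount_union_add_le (B M E : Finset G) (hBM : Disjoint B M) :
    tripleCount E (B ∪ M) (B ∪ M) ≤ tripleCount E B B + 2 * (#E * #M) := by
  rw [tripleCount_union_right hBM, tripleCount_union_mid hBM]
  have h1 := tripleCount_le_card_mul_card_left E (B ∪ M) M
  have h2 := tripleCount_le_card_mul_card E M B
  omega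

lemma tripleCount_union_add_le' (B M E : Finset G) (hBM : Disjoint B M) :
    tripleCount (B ∪ M) (B ∪ M) E ≤ tripleCount B B E + 2 * (#E * #M) := by
  rw [tripleCount_union_left hBM, tripleCount_union_mid hBM]
  have h1 := tripleCount_le_card_mul_card_left M (B ∪ M) E
  have h2 := tripleCount_le_card_mul_card_right B M E
  rw [mul_comm] at h1 h2
  rw [mul_comm #E]
  nlinarith

lemma isSumFree_of_ST_eq_zero {A : Finset G} (h : ST A = 0) : IsSumFree A := by
  intro x hx y hy z hz hxyz
  rw [ST, card_eq_zero, filter_eq_empty_iff] at h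
  exact h (x := (x, y, z)) (mem_product.2 ⟨hx, mem_product.2 ⟨hy, hz⟩⟩) hxyz

lemma IsSumFree.ST_eq_zero {A : Finset G} (h : IsSumFree A) : ST A = 0 := by
  rw [ST_eq_tripleCount]
  exact tripleCount_eq_zero fun x hx y hy hz ↦ h x hx y hy _ hz rfl

end Counting

/-! ### Arithmetic of the middle interval -/

section MiddleInterval

open Finset

lemma natCast_mem_middleInterval {p k n : ℕ} (h1 : k + 1 ≤ n) (h2 : n ≤ 2 * k + 1) :
    (n : ZMod p) ∈ middleInterval p k :=
  mem_image_of_mem _ (mem_Icc.2 ⟨h1, h2⟩)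

lemma card_middleInterval {p k : ℕ} (h : 2 * k + 1 < p) : #(middleInterval p k) = k + 1 := by
  rw [middleInterval, card_image_of_injOn, Nat.card_Icc]
  · omega
  · intro i hi j hj hij
    simp only [coe_Icc, Set.mem_Icc] at hi hj
    have := congrArg ZMod.val hij
    rwa [ZMod.val_natCast_of_lt (by omega), ZMod.val_natCast_of_lt (by omega)] at this

lemma isSumFree_middleInterval {p k : ℕ} (h : 3 * k + 2 ≤ p) :
    IsSumFree (middleInterval p k) := by
  have : NeZero p := ⟨by omega⟩
  intro x hx y hy z hz hxyz
  rw [mem_middleInterval (by omega)] at hx hy hz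
  rw [← hxyz, ZMod.val_add] at hz
  rcases lt_or_ge (x.val + y.val) p with hlt | hge
  · rw [Nat.mod_eq_of_lt hlt] at hz
    omega
  · rw [Nat.mod_eq_sub_mod hge, Nat.mod_eq_of_lt (by omega)] at hz
    omega

variable {p k : ℕ}

lemma neg_mem_middleInterval_iff (hpk : p = 3 * k + 2) (x : ZMod p) :
    -x ∈ middleInterval p k ↔ x ∈ middleInterval p k := by
  have : NeZero p := ⟨by omega⟩
  rw [mem_middleInterval (by omega), mem_middleInterval (by omega), ZMod.neg_val]
  split_ifs with h
  · simp [h]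
  · have := ZMod.val_lt x
    omega

lemma natCast_notMem_middleInterval (hpk : p = 3 * k + 2) :
    (k : ZMod p) ∉ middleInterval p k := by
  have : NeZero p := ⟨by omega⟩
  rw [mem_middleInterval (by omega), ZMod.val_natCast_of_lt (by omega)]
  omega

/-- Translation by `k` moves only the left endpoint of the interval back into it; hence a point over
`k` costs as little as possible. -/
lemma add_natCast_mem_middleInterval_iff (hpk : p = 3 * k + 2) (y : ZMod p) :
    (y ∈ middleInterval p k ∧ k + y ∈ middleInterval p k) ↔ y = (k + 1 : ℕ) := by
  have : NeZero p := ⟨by omega⟩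
  constructor
  · rintro ⟨hy, hky⟩
    rw [mem_middleInterval (by omega)] at hy hky
    rw [ZMod.val_add, ZMod.val_natCast_of_lt (by omega)] at hky
    rcases lt_or_ge (k + y.val) p with hlt | hge
    · rw [Nat.mod_eq_of_lt hlt] at hky
      rw [← ZMod.natCast_zmod_val y]
      congr 1
      omega
    · omega
  · rintro rfl
    refine ⟨natCast_mem_middleInterval (by omega) (by omega), ?_⟩
    rw [← Nat.cast_add]
    exact natCast_mem_middleInterval (by omega) (by omega)

/-- Use the left endpoint `k + 1` for `j ≤ k`, and the right endpoint `2k + 1`, wrapping around, for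
`j ≥ 2k + 2`. -/
lemma exists_add_mem_middleInterval (hpk : p = 3 * k + 2) {j : ZMod p}
    (hj : j ∉ middleInterval p k) : ∃ y ∈ middleInterval p k, j + y ∈ middleInterval p k := by
  have : NeZero p := ⟨by omega⟩
  rw [mem_middleInterval (by omega)] at hj
  have hlt := ZMod.val_lt j
  by_cases h : j.val ≤ k
  · refine ⟨(k + 1 : ℕ), natCast_mem_middleInterval (by omega) (by omega), ?_⟩
    rw [← ZMod.natCast_zmod_val j, ← Nat.cast_add]
    exact natCast_mem_middleInterval (by omega) (by omega)
  · refine ⟨(2 * k + 1 : ℕ), natCast_mem_middleInterval (by omega) (by omega), ?_⟩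
    have : j + (2 * k + 1 : ℕ) = (j.val + (2 * k + 1) - p : ℕ) := by
      rw [Nat.cast_sub (by omega), Nat.cast_add j.val, ZMod.natCast_zmod_val]
      simp
    rw [this]
    exact natCast_mem_middleInterval (by omega) (by omega)

/-- Away from `±k` the neighbour of the endpoint, `k + 2` or `2k`, works as well. -/
lemma exists_pair_add_mem_middleInterval (hpk : p = 3 * k + 2) {j : ZMod p}
    (hj : j ∉ middleInterval p k) (hjk : j ≠ k) (hjk' : j ≠ -k) :
    ∃ y ∈ middleInterval p k, ∃ y' ∈ middleInterval p k, y ≠ y' ∧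
      j + y ∈ middleInterval p k ∧ j + y' ∈ middleInterval p k := by
  have : NeZero p := ⟨by omega⟩
  rw [mem_middleInterval (by omega)] at hj
  have hlt := ZMod.val_lt j
  have hjv : j.val ≠ k := fun h ↦ hjk (by rw [← h, ZMod.natCast_zmod_val])
  have hjv' : j.val ≠ 2 * k + 2 := fun h ↦ hjk' (by
    rw [← ZMod.natCast_zmod_val j, h, eq_neg_iff_add_eq_zero, ← Nat.cast_add,
      show 2 * k + 2 + k = p by omega, ZMod.natCast_self])
  have hne : ∀ a b : ℕ, a < p → b < p → a ≠ b → (a : ZMod p) ≠ b := fun a b ha hb hab h ↦ by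
    have := congrArg ZMod.val h
    rw [ZMod.val_natCast_of_lt ha, ZMod.val_natCast_of_lt hb] at this
    exact hab this
  by_cases h : j.val ≤ k
  · refine ⟨(k + 1 : ℕ), natCast_mem_middleInterval (by omega) (by omega), (k + 2 : ℕ),
      natCast_mem_middleInterval (by omega) (by omega), hne _ _ (by omega) (by omega) (by omega),
      ?_, ?_⟩ <;>
    · rw [← ZMod.natCast_zmod_val j, ← Nat.cast_add]
      exact natCast_mem_middleInterval (by omega) (by omega)
  · refine ⟨(2 * k + 1 : ℕ), natCast_mem_middleInterval (by omega) (by omega), (2 * k : ℕ),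
      natCast_mem_middleInterval (by omega) (by omega), hne _ _ (by omega) (by omega) (by omega),
      ?_, ?_⟩
    · have : j + (2 * k + 1 : ℕ) = (j.val + (2 * k + 1) - p : ℕ) := by
        rw [Nat.cast_sub (by omega), Nat.cast_add j.val, ZMod.natCast_zmod_val]
        simp
      rw [this]
      exact natCast_mem_middleInterval (by omega) (by omega)
    · have : j + (2 * k : ℕ) = (j.val + 2 * k - p : ℕ) := by
        rw [Nat.cast_sub (by omega), Nat.cast_add j.val, ZMod.natCast_zmod_val]
        simp
      rw [this]
      exact natCast_mem_middleInterval (by omega) (by omega)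

end MiddleInterval

/-! ### Preimages, fibres and the exact count for the extremal sets -/

section Fibres

open Finset
open scoped Pointwise

variable {G : Type u} [AddCommGroup G] [Fintype G] {p k : ℕ}

lemma mem_middlePreimage {φ : G →+ ZMod p} {x : G} :
    x ∈ middlePreimage k φ ↔ φ x ∈ middleInterval p k := by
  simp [middlePreimage]

lemma mem_fibre {φ : G →+ ZMod p} {x : G} : x ∈ fibre k φ ↔ φ x = k := by
  simp [fibre]

lemma card_filter_eq_card_filter_zero {Q : Type*} [AddCommGroup Q] [DecidableEq Q] {φ : G →+ Q}
    (hφ : Function.Surjective φ) (j : Q) :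
    #(univ.filter fun x : G ↦ φ x = j) = #(univ.filter fun x : G ↦ φ x = 0) := by
  obtain ⟨g, rfl⟩ := hφ j
  symm
  refine card_bij (fun x _ ↦ g + x) ?_ ?_ ?_
  · intro x hx
    simpa using hx
  · intro x _ y _ h
    exact add_left_cancel h
  · intro y hy
    rw [mem_filter] at hy
    exact ⟨y - g, by simp [hy.2], by abel⟩

lemma card_filter_mem {Q : Type*} [AddCommGroup Q] [DecidableEq Q] {φ : G →+ Q}
    (hφ : Function.Surjective φ) (I : Finset Q) :
    #(univ.filter fun x : G ↦ φ x ∈ I) = #I * #(univ.filter fun x : G ↦ φ x = 0) := by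
  rw [card_eq_sum_card_fiberwise (f := φ) (t := I) fun x hx ↦ by simpa using hx,
    ← smul_eq_mul, ← sum_const]
  refine sum_congr rfl fun j hj ↦ ?_
  rw [← card_filter_eq_card_filter_zero hφ j, filter_filter]
  congr 1
  ext x
  simp only [mem_filter, mem_univ, true_and]
  exact ⟨fun h ↦ h.2, fun h ↦ ⟨h ▸ hj, h⟩⟩

lemma card_eq_card_mul_card_filter_zero {Q : Type*} [AddCommGroup Q] [Fintype Q] [DecidableEq Q]
    {φ : G →+ Q} (hφ : Function.Surjective φ) :
    Fintype.card G = Fintype.card Q * #(univ.filter fun x : G ↦ φ x = 0) := by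
  simpa using card_filter_mem hφ univ

lemma card_filter_eq [NeZero p] {φ : G →+ ZMod p} (hφ : Function.Surjective φ) {w : ℕ}
    (hw : Fintype.card G = p * w) (j : ZMod p) : #(univ.filter fun x : G ↦ φ x = j) = w := by
  have h := card_eq_card_mul_card_filter_zero hφ
  rw [ZMod.card] at h
  rw [card_filter_eq_card_filter_zero hφ j]
  exact Nat.eq_of_mul_eq_mul_left (NeZero.pos p) (h.symm.trans hw)

lemma card_middlePreimage (hpk : 2 * k + 1 < p) {φ : G →+ ZMod p} (hφ : Function.Surjective φ)
    {w : ℕ} (hw : Fintype.card G = p * w) : #(middlePreimage k φ) = (k + 1) * w := by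
  have : NeZero p := ⟨by omega⟩
  rw [middlePreimage, card_filter_mem hφ, card_middleInterval hpk, card_filter_eq hφ hw]

lemma card_fibre [NeZero p] {φ : G →+ ZMod p} (hφ : Function.Surjective φ) {w : ℕ}
    (hw : Fintype.card G = p * w) : #(fibre k φ) = w :=
  card_filter_eq hφ hw _

lemma isSumFree_middlePreimage (h : 3 * k + 2 ≤ p) (φ : G →+ ZMod p) :
    IsSumFree (middlePreimage k φ) := by
  intro x hx y hy z hz hxyz
  rw [mem_middlePreimage] at hx hy hz
  exact isSumFree_middleInterval h _ hx _ hy _ hz (by rw [← hxyz, map_add])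

lemma disjoint_middlePreimage_fibre (hpk : p = 3 * k + 2) (φ : G →+ ZMod p) :
    Disjoint (middlePreimage k φ) (fibre k φ) := by
  rw [disjoint_left]
  intro x hx hx'
  rw [mem_middlePreimage] at hx
  rw [mem_fibre] at hx'
  exact natCast_notMem_middleInterval hpk (hx' ▸ hx)

lemma middlePreimage_neg (hpk : p = 3 * k + 2) (φ : G →+ ZMod p) :
    middlePreimage k (-φ) = middlePreimage k φ := by
  ext x
  rw [mem_middlePreimage, mem_middlePreimage, AddMonoidHom.neg_apply,
    neg_mem_middleInterval_iff hpk]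

variable [DecidableEq G]

lemma neg_middlePreimage (hpk : p = 3 * k + 2) (φ : G →+ ZMod p) :
    -middlePreimage k φ = middlePreimage k φ := by
  ext x
  rw [mem_neg', mem_middlePreimage, mem_middlePreimage, map_neg,
    neg_mem_middleInterval_iff hpk]

lemma tripleCount_middlePreimage_rotate (hpk : p = 3 * k + 2) (φ : G →+ ZMod p) (E : Finset G) :
    tripleCount (middlePreimage k φ) (middlePreimage k φ) E =
      tripleCount E (middlePreimage k φ) (middlePreimage k φ) := by
  rw [tripleCount_rotate, neg_middlePreimage hpk]

/-- The number of Schur triples in `φ⁻¹{k + 1, …, 2 k + 1} ∪ A'`, for `A'` in the fibre of `k`. -/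
theorem ST_middlePreimage_union (hpk : p = 3 * k + 2) {φ : G →+ ZMod p}
    (hφ : Function.Surjective φ) {w : ℕ} (hw : Fintype.card G = p * w) {E : Finset G}
    (hE : E ⊆ fibre k φ) :
    ST (middlePreimage k φ ∪ E) = 3 * #E * w + (if p ≠ 2 then 1 else 0) * #E ^ 2 + ST E := by
  have : NeZero p := ⟨by omega⟩
  have hk : ∀ x ∈ E, φ x = k := fun x hx ↦ mem_fibre.1 (hE hx)
  have hdisj : Disjoint (middlePreimage k φ) E :=
    (disjoint_middlePreimage_fibre hpk φ).mono_right hE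
  have h0 : (0 : ZMod p) ∉ middleInterval p k := by
    rw [mem_middleInterval (by omega)]
    simp
  have hEAA : tripleCount E (middlePreimage k φ) (middlePreimage k φ) = #E * w := by
    rw [tripleCount_eq_sum_card, ← smul_eq_mul, ← sum_const]
    refine sum_congr rfl fun x hx ↦ ?_
    rw [← card_filter_eq hφ hw (k + 1 : ℕ)]
    congr 1
    ext y
    rw [mem_filter, mem_middlePreimage, mem_middlePreimage, map_add, hk x hx,
      add_natCast_mem_middleInterval_iff hpk]
    simp
  -- Sums of two elements of `E` lie over `2k`, which is in the interval unless `k = 0`; this is the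
  -- source of the indicator.
  have hEEA : tripleCount E E (middlePreimage k φ) = (if p ≠ 2 then 1 else 0) * #E ^ 2 := by
    split_ifs with h2
    · rw [tripleCount_eq_card_mul_card, one_mul, sq]
      intro x hx y hy
      rw [mem_middlePreimage, map_add, hk x hx, hk y hy, ← Nat.cast_add]
      exact natCast_mem_middleInterval (by omega) (by omega)
    · rw [tripleCount_eq_zero, zero_mul]
      intro x hx y hy
      obtain rfl : k = 0 := by omega
      rw [mem_middlePreimage, map_add, hk x hx, hk y hy]
      simpa using h0
  have hEAE : tripleCount E (middlePreimage k φ) E = 0 := by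
    apply tripleCount_eq_zero
    intro x hx y hy hxy
    have := hk _ hxy
    rw [map_add, hk x hx, add_eq_left] at this
    rw [mem_middlePreimage, this] at hy
    exact h0 hy
  have hAAA : tripleCount (middlePreimage k φ) (middlePreimage k φ) (middlePreimage k φ) = 0 := by
    rw [← ST_eq_tripleCount]
    exact (isSumFree_middlePreimage hpk.ge φ).ST_eq_zero
  rw [ST_eq_tripleCount, ST_eq_tripleCount E]
  simp only [tripleCount_union_left hdisj, tripleCount_union_mid hdisj,
    tripleCount_union_right hdisj]
  rw [hAAA, tripleCount_middlePreimage_rotate hpk, tripleCount_comm (middlePreimage k φ) E,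
    tripleCount_comm (middlePreimage k φ) E, hEAA, hEEA, hEAE]
  ring

end Fibres

/-! ### The extremal problem near `φ⁻¹{k + 1, …, 2k + 1}` -/

section Stability

open Finset
open scoped Pointwise

variable {G : Type u} [AddCommGroup G] [Fintype G] [DecidableEq G] {p k : ℕ}

/-- Elements outside of `φ⁻¹{k + 1, …, 2 k + 1}` lie in many Schur triples, and in twice as many
if they are not in the fibre of `k` or `-k`. -/
lemma card_mul_add_le_tripleCount (hpk : p = 3 * k + 2) {φ : G →+ ZMod p}
    (hφ : Function.Surjective φ) {w : ℕ} (hw : Fintype.card G = p * w) {E : Finset G}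
    (hE : Disjoint E (middlePreimage k φ)) :
    #E * w + #(E.filter fun x ↦ φ x ≠ k ∧ φ x ≠ -k) * w ≤
      tripleCount E (middlePreimage k φ) (middlePreimage k φ) := by
  have : NeZero p := ⟨by omega⟩
  rw [tripleCount_eq_sum_card, card_filter, sum_mul, card_eq_sum_ones, sum_mul,
    ← sum_add_distrib]
  refine sum_le_sum fun x hx ↦ ?_
  have hxI : φ x ∉ middleInterval p k := fun h ↦
    disjoint_left.1 hE hx (mem_middlePreimage.2 h)
  split_ifs with h
  · obtain ⟨y, hy, y', hy', hne, hxy, hxy'⟩ :=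
      exists_pair_add_mem_middleInterval hpk hxI h.1 h.2
    rw [one_mul, ← card_filter_eq hφ hw y]
    nth_rw 2 [card_filter_eq hφ hw y]
    rw [← card_filter_eq hφ hw y', ← card_union_of_disjoint]
    · apply card_le_card
      intro z hz
      rw [mem_filter, mem_middlePreimage, mem_middlePreimage, map_add]
      rcases mem_union.1 hz with hz | hz <;> rw [(mem_filter.1 hz).2]
      · exact ⟨hy, hxy⟩
      · exact ⟨hy', hxy'⟩
    · rw [disjoint_left]
      intro z hz hz'
      exact hne ((mem_filter.1 hz).2.symm.trans (mem_filter.1 hz').2)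
  · obtain ⟨y, hy, hxy⟩ := exists_add_mem_middleInterval hpk hxI
    rw [zero_mul, add_zero, one_mul, ← card_filter_eq hφ hw y]
    apply card_le_card
    intro z hz
    rw [mem_filter, mem_middlePreimage, mem_middlePreimage, map_add, (mem_filter.1 hz).2]
    exact ⟨hy, hxy⟩

/-- For `k > 0` both `2k` and `-2k` lie in the middle interval, so any two elements over the same
point of `±k` have their sum in the preimage. -/
lemma sq_add_sq_le_tripleCount (hpk : p = 3 * k + 2) (hk : 0 < k) {φ : G →+ ZMod p}
    {E₁ E₂ E : Finset G} (h1 : ∀ x ∈ E₁, φ x = k) (h2 : ∀ x ∈ E₂, φ x = -k)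
    (hdisj : Disjoint E₁ E₂) (hE : E₁ ∪ E₂ ⊆ E) :
    #E₁ ^ 2 + #E₂ ^ 2 ≤ tripleCount E E (middlePreimage k φ) := by
  have hkk : ((k : ZMod p) + k) ∈ middleInterval p k := by
    rw [← Nat.cast_add]
    exact natCast_mem_middleInterval (by omega) (by omega)
  calc _ = tripleCount E₁ E₁ (middlePreimage k φ) + tripleCount E₂ E₂ (middlePreimage k φ) := by
        rw [tripleCount_eq_card_mul_card, tripleCount_eq_card_mul_card, sq, sq]
        · intro x hx y hy
          rwa [mem_middlePreimage, map_add, h2 x hx, h2 y hy, ← neg_add,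
            neg_mem_middleInterval_iff hpk]
        · intro x hx y hy
          rwa [mem_middlePreimage, map_add, h1 x hx, h1 y hy]
    _ ≤ tripleCount (E₁ ∪ E₂) (E₁ ∪ E₂) (middlePreimage k φ) := by
        simp only [tripleCount_union_left hdisj, tripleCount_union_mid hdisj]
        omega
    _ ≤ _ := (tripleCount_mono_left hE _ _).trans (tripleCount_mono_mid hE _ _)

lemma two_mul_le_tripleCount (hpk : p = 3 * k + 2) (hk : 0 < k) {φ : G →+ ZMod p}
    {E₁ E₂ E : Finset G} (h1 : ∀ x ∈ E₁, φ x = k) (h2 : ∀ x ∈ E₂, φ x = -k)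
    (hdisj : Disjoint E₁ E₂) (hE : E₁ ∪ E₂ ⊆ E) :
    2 * (#E₁ * #E₂) ≤ tripleCount E (middlePreimage k φ) E := by
  have hkk : ((k : ZMod p) + k) ∈ middleInterval p k := by
    rw [← Nat.cast_add]
    exact natCast_mem_middleInterval (by omega) (by omega)
  calc _ = tripleCount E₁ (middlePreimage k φ) E₂ + tripleCount E₂ (middlePreimage k φ) E₁ := by
        rw [tripleCount_eq_card_mul_card_left, tripleCount_eq_card_mul_card_left]
        · ring
        · intro x hx y hy
          rwa [mem_middlePreimage, map_sub, h2 x hx, h1 y hy, sub_neg_eq_add]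
        · intro x hx y hy
          rwa [mem_middlePreimage, map_sub, h1 x hx, h2 y hy, ← neg_add',
            neg_mem_middleInterval_iff hpk]
    _ ≤ tripleCount (E₁ ∪ E₂) (middlePreimage k φ) (E₁ ∪ E₂) := by
        simp only [tripleCount_union_left hdisj, tripleCount_union_right hdisj]
        omega
    _ ≤ _ := (tripleCount_mono_left hE _ _).trans (tripleCount_mono_right hE _ _)

/-- A lower bound for the number of Schur triples of a set close to
`A₀ = φ⁻¹{k + 1, …, 2 k + 1}`. -/
lemma lower_bound_ST (hpk : p = 3 * k + 2) {φ : G →+ ZMod p}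
    (hφ : Function.Surjective φ) {w : ℕ} (hw : Fintype.card G = p * w) (A : Finset G)
    {M E E₁ E₂ E₃ : Finset G} (hM : M = middlePreimage k φ \ A) (hE : E = A \ middlePreimage k φ)
    (hE₁ : E₁ = E.filter fun x ↦ φ x = k) (hE₂ : E₂ = E.filter fun x ↦ φ x ≠ k ∧ φ x = -k)
    (hE₃ : E₃ = E.filter fun x ↦ φ x ≠ k ∧ φ x ≠ -k) :
    #E = #E₁ + #E₂ + #E₃ ∧
    3 * (#E * w + #E₃ * w) + (if p ≠ 2 then 1 else 0) * (#E₁ ^ 2 + #E₂ ^ 2 + 4 * (#E₁ * #E₂)) ≤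
      ST A + 9 * (#E * #M) := by
  have : NeZero p := ⟨by omega⟩
  set A₀ := middlePreimage k φ with hA₀
  set B := A ∩ A₀ with hB
  have hBM : Disjoint B M := by
    rw [hM]
    exact disjoint_sdiff.mono_left inter_subset_left
  have hBE : Disjoint B E := by
    rw [hE]
    exact disjoint_sdiff.mono_left inter_subset_right
  have hA₀' : A₀ = B ∪ M := by
    rw [hB, hM, union_comm, inter_comm]
    exact (sdiff_union_inter _ _).symm
  have hA : A = B ∪ E := by
    rw [hB, hE, union_comm]
    exact (sdiff_union_inter _ _).symm
  have hcard : #E = #E₁ + #E₂ + #E₃ := by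
    rw [hE₁, hE₂, hE₃, ← card_filter_add_card_filter_not (s := E) (fun x ↦ φ x = k), add_assoc,
      ← card_filter_add_card_filter_not (s := E.filter fun x ↦ ¬ φ x = k) (fun x ↦ φ x = -k),
      filter_filter, filter_filter]
  refine ⟨hcard, ?_⟩
  have hE0 : Disjoint E A₀ := by
    rw [hE]
    exact sdiff_disjoint
  have hbig := card_mul_add_le_tripleCount hpk hφ hw hE0
  rw [← hE₃] at hbig
  have hbig' := hbig
  rw [← tripleCount_middlePreimage_rotate hpk, ← hA₀, hA₀'] at hbig'
  rw [← hA₀, hA₀'] at hbig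
  replace hbig := hbig.trans (tripleCount_union_add_le B M E hBM)
  replace hbig' := hbig'.trans (tripleCount_union_add_le' B M E hBM)
  -- The six mixed families of triples in `B ∪ E`. The first three each lose at most `2 * (#E * #M)`
  -- against `A₀`, the last three at most `#E * #M`: in total `9 * (#E * #M)`.
  have hST : tripleCount E B B + tripleCount E B B + tripleCount B B E + tripleCount E E B +
      tripleCount E B E + tripleCount E B E ≤ ST A := by
    rw [ST_eq_tripleCount, hA]
    simp only [tripleCount_union_left hBE, tripleCount_union_mid hBE, tripleCount_union_right hBE,
      tripleCount_comm B E]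
    omega
  split_ifs with h2
  · have hk : 0 < k := by omega
    have h12 : Disjoint E₁ E₂ := by
      rw [disjoint_left, hE₁, hE₂]
      intro x hx hx'
      exact (mem_filter.1 hx').2.1 (mem_filter.1 hx).2
    have hsub : E₁ ∪ E₂ ⊆ E := by
      rw [hE₁, hE₂]
      exact union_subset (filter_subset _ _) (filter_subset _ _)
    have hm1 : ∀ x ∈ E₁, φ x = k := fun x hx ↦ by
      rw [hE₁] at hx
      exact (mem_filter.1 hx).2
    have hm2 : ∀ x ∈ E₂, φ x = -k := fun x hx ↦ by
      rw [hE₂] at hx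
      exact (mem_filter.1 hx).2.2
    have hsq := sq_add_sq_le_tripleCount hpk hk hm1 hm2 h12 hsub
    have htw := two_mul_le_tripleCount hpk hk hm1 hm2 h12 hsub
    rw [← hA₀, hA₀', tripleCount_union_right hBM] at hsq
    rw [← hA₀, hA₀', tripleCount_union_mid hBM] at htw
    have h3 := tripleCount_le_card_mul_card_left E E M
    have h4 := tripleCount_le_card_mul_card_left M E E
    rw [tripleCount_comm, mul_comm] at h4
    omega
  · omega

/-- The extremal result for sets close to `φ⁻¹{k + 1, …, 2 k + 1}`. -/
theorem ST_ge_of_close (hpk : p = 3 * k + 2) {φ : G →+ ZMod p}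
    (hφ : Function.Surjective φ) {w s : ℕ} (hw : Fintype.card G = p * w) (A : Finset G)
    (hA : #A = (k + 1) * w + s) (hclose : 4 * (s + #(middlePreimage k φ \ A)) ≤ w) :
    3 * s * w + (if p ≠ 2 then 1 else 0) * s ^ 2 ≤ ST A ∧
    (ST A = 3 * s * w + (if p ≠ 2 then 1 else 0) * s ^ 2 →
      ∃ ψ : G →+ ZMod p, Function.Surjective ψ ∧ ∃ A' : Finset G, A' ⊆ fibre k ψ ∧
        IsSumFree A' ∧ #A' = s ∧ A = middlePreimage k ψ ∪ A') := by
  have : NeZero p := ⟨by omega⟩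
  have hwpos : 0 < w := by
    have : 0 < Fintype.card G := Fintype.card_pos
    rw [hw] at this
    exact Nat.pos_of_mul_pos_left this
  obtain ⟨M, hM⟩ : ∃ M, M = middlePreimage k φ \ A := ⟨_, rfl⟩
  obtain ⟨E, hE⟩ : ∃ E, E = A \ middlePreimage k φ := ⟨_, rfl⟩
  obtain ⟨E₁, hE₁⟩ : ∃ E₁, E₁ = E.filter fun x ↦ φ x = k := ⟨_, rfl⟩
  obtain ⟨E₂, hE₂⟩ : ∃ E₂, E₂ = E.filter fun x ↦ φ x ≠ k ∧ φ x = -k := ⟨_, rfl⟩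
  obtain ⟨E₃, hE₃⟩ : ∃ E₃, E₃ = E.filter fun x ↦ φ x ≠ k ∧ φ x ≠ -k := ⟨_, rfl⟩
  obtain ⟨hcard, hST⟩ := lower_bound_ST hpk hφ hw A hM hE hE₁ hE₂ hE₃
  have hEs : #E = s + #M := by
    have h1 := card_sdiff_add_card_inter A (middlePreimage k φ)
    have h2 := card_sdiff_add_card_inter (middlePreimage k φ) A
    rw [card_middlePreimage (by omega) hφ hw, inter_comm] at h2
    rw [hE, hM]
    omega
  rw [← hM] at hclose
  -- Since `#E = s + #M`, the gain `3 * #M * w` dominates the loss `9 * #E * #M ≤ (9 / 4) * #M * w`.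
  -- The surplus terms on the left must vanish in case of equality.
  have hgain : 3 * s * w + (if p ≠ 2 then 1 else 0) * s ^ 2 + #M + #E₃ +
      (if p ≠ 2 then 1 else 0) * (#E₁ * #E₂) ≤ ST A := by
    have h1 := Nat.mul_le_mul_left #M hclose
    have h2 := Nat.mul_le_mul_left #E₃ hclose
    have h3 := Nat.mul_le_mul_left #E₃ hwpos
    have h4 : #M ≤ #M * (s + #M) := by
      rcases Nat.eq_zero_or_pos #M with h | h
      · simp [h]
      · exact Nat.le_mul_of_pos_right _ (by omega)
    rw [hEs] at hST hcard
    split_ifs at hST ⊢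
    · have h5 : (s : ℤ) ^ 2 + 2 * s * (#M - #E₃) ≤ (#E₁ + #E₂) ^ 2 := by
        rw [show (#E₁ : ℤ) + #E₂ = s + #M - #E₃ by omega]
        linarith [sq_nonneg ((#M : ℤ) - #E₃)]
      have h6 : (0 : ℤ) ≤ s * #M := by positivity
      have h7 : (0 : ℤ) ≤ #E₁ * #E₂ := by positivity
      have h8 : (0 : ℤ) ≤ #E₃ * #M := by positivity
      have h9 : (0 : ℤ) ≤ #E₃ * s := by positivity
      clear hcard hclose hEs hM hE hE₁ hE₂ hE₃
      zify at h1 h2 h3 h4 hST ⊢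
      linarith
    · nlinarith
  refine ⟨by omega, fun heq ↦ ?_⟩
  have hM0 : M = ∅ := by
    rw [← card_eq_zero]
    omega
  have hE0 : E₃ = ∅ := by
    rw [← card_eq_zero]
    omega
  have hAE : A = middlePreimage k φ ∪ E := by
    rw [hE, union_sdiff_self_eq_union, eq_comm, union_eq_right, ← sdiff_eq_empty_iff_subset,
      ← hM, hM0]
  have hEcard : #E = s := by
    rw [hEs, hM0, card_empty, add_zero]
  have key : ∀ ψ : G →+ ZMod p, Function.Surjective ψ →
      middlePreimage k ψ = middlePreimage k φ → E ⊆ fibre k ψ →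
      ∃ ψ : G →+ ZMod p, Function.Surjective ψ ∧ ∃ A' : Finset G, A' ⊆ fibre k ψ ∧
        IsSumFree A' ∧ #A' = s ∧ A = middlePreimage k ψ ∪ A' := by
    intro ψ hψ hψφ hEψ
    refine ⟨ψ, hψ, E, hEψ, isSumFree_of_ST_eq_zero ?_, hEcard, by rw [hψφ, hAE]⟩
    have := ST_middlePreimage_union hpk hψ hw hEψ
    rw [hψφ, ← hAE, hEcard] at this
    omega
  have h3 : ∀ x ∈ E, φ x ≠ k → φ x = -k := by
    intro x hx hxk
    by_contra hxk'
    have : x ∈ E₃ := by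
      rw [hE₃]
      exact mem_filter.2 ⟨hx, hxk, hxk'⟩
    simp [hE0] at this
  by_cases h2 : E₂ = ∅
  · refine key φ hφ rfl fun x hx ↦ mem_fibre.2 ?_
    by_contra hxk
    have : x ∈ E₂ := by
      rw [hE₂]
      exact mem_filter.2 ⟨hx, hxk, h3 x hx hxk⟩
    simp [h2] at this
  · obtain ⟨x, hx⟩ := nonempty_iff_ne_empty.2 h2
    -- For `p = 2` the residues `k` and `-k` are both `0`, so `E₂` would be empty.
    have hp2 : p ≠ 2 := by
      rintro rfl
      obtain rfl : k = 0 := by omega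
      rw [hE₂, mem_filter] at hx
      exact hx.2.1 (by simpa using hx.2.2)
    rw [if_pos hp2, one_mul] at hgain heq
    have h12 : #E₁ * #E₂ = 0 := by omega
    have h1 : E₁ = ∅ := by
      rcases mul_eq_zero.1 h12 with h | h
      · exact card_eq_zero.1 h
      · exact absurd (card_eq_zero.1 h) h2
    -- All new elements lie over `-k`; the interval is symmetric, so `-φ` puts them over `k`.
    refine key (-φ) (fun y ↦ ?_) (middlePreimage_neg hpk φ) fun x hx ↦ mem_fibre.2 ?_
    · obtain ⟨g, hg⟩ := hφ (-y)
      exact ⟨g, by simp [hg]⟩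
    · have hxk : φ x ≠ k := fun hxk ↦ by
        have : x ∈ E₁ := by
          rw [hE₁]
          exact mem_filter.2 ⟨hx, hxk⟩
        simp [h1] at this
      rw [AddMonoidHom.neg_apply, h3 x hx hxk, neg_neg]

end Stability

/-! ### Surjections onto `ℤ/p` and sum-free sets in fibres -/

open Finset
open scoped Pointwise

lemma exists_surjective_zmod_of_ne_zero {p : ℕ} [Fact p.Prime] {V : Type u} [AddCommGroup V]
    [Module (ZMod p) V] {v : V} (hv : v ≠ 0) : ∃ f : V →+ ZMod p, Function.Surjective f := by
  obtain ⟨f, hf⟩ : ∃ f : V →ₗ[ZMod p] ZMod p, f v ≠ 0 := by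
    by_contra! hall
    exact hv ((Module.forall_dual_apply_eq_zero_iff (ZMod p) v).1 hall)
  exact ⟨f.toAddMonoidHom, LinearMap.surjective_of_ne_zero fun h0 ↦ hf (by simp [h0])⟩

/-- By Cauchy's theorem multiplication by `p` is not injective, hence not surjective, so `G / pG` is
a nonzero vector space over `ℤ/p` and has a nonzero functional. -/
lemma exists_surjective_zmod {p : ℕ} (hp : p.Prime) (G : Type u) [AddCommGroup G] [Fintype G]
    (h : p ∣ Fintype.card G) : ∃ φ : G →+ ZMod p, Function.Surjective φ := by
  have : Fact p.Prime := ⟨hp⟩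
  let H : AddSubgroup G := (nsmulAddMonoidHom (α := G) p).range
  have hmod : ∀ x : G, p • x ∈ H := fun x ↦ ⟨x, rfl⟩
  let _ : Module (ZMod p) (G ⧸ H) := QuotientAddGroup.zmodModule hmod
  have hH : ∃ g : G, g ∉ H := by
    by_contra! hall
    have hinj : Function.Injective (nsmulAddMonoidHom (α := G) p) :=
      Finite.injective_iff_surjective.2 fun g ↦ hall g
    obtain ⟨x, hx⟩ := exists_prime_addOrderOf_dvd_card p h
    have h0 : x = 0 := hinj (by
      rw [map_zero, nsmulAddMonoidHom_apply, ← hx, addOrderOf_nsmul_eq_zero])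
    rw [h0, addOrderOf_zero] at hx
    exact hp.one_lt.ne hx
  obtain ⟨g, hg⟩ := hH
  have hg' : (QuotientAddGroup.mk' H g) ≠ 0 := by
    rwa [Ne, QuotientAddGroup.mk'_apply, QuotientAddGroup.eq_zero_iff]
  obtain ⟨f, hf⟩ := exists_surjective_zmod_of_ne_zero (p := p) hg'
  exact ⟨f.comp (QuotientAddGroup.mk' H), hf.comp (QuotientAddGroup.mk'_surjective H)⟩

/-- A finite abelian group has sum-free subsets of every density up to `2 / 7`. -/
lemma exists_isSumFree_card_eq (G : Type u) [AddCommGroup G] [Fintype G] (t : ℕ)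
    (ht : 7 * t ≤ 2 * Fintype.card G) : ∃ S : Finset G, IsSumFree S ∧ #S = t := by
  classical
  by_cases h1 : Fintype.card G = 1
  · obtain rfl : t = 0 := by omega
    exact ⟨∅, by simp [IsSumFree], card_empty⟩
  obtain ⟨q, hq, hqG⟩ := Nat.exists_prime_and_dvd h1
  obtain ⟨w, hw⟩ := hqG
  obtain ⟨ψ, hψ⟩ := exists_surjective_zmod hq G ⟨w, hw⟩
  have hq2 := hq.two_le
  have hq4 : q ≠ 4 := by
    rintro rfl
    exact absurd hq (by norm_num)
  -- The middle interval in `ℤ/q` has `⌊(q + 1) / 3⌋` elements; over the primes this density is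
  -- least at `q = 7`. Only `q = 4` would fall below `2 / 7`.
  obtain ⟨j, hj⟩ : ∃ j, (q + 1) / 3 = j + 1 := ⟨(q + 1) / 3 - 1, by omega⟩
  have hcard := card_middlePreimage (k := j) (by omega) hψ hw
  have hqj : 2 * q ≤ 7 * (j + 1) := by omega
  have hle : t ≤ #(middlePreimage j ψ) := by
    rw [hcard]
    have := Nat.mul_le_mul_right w hqj
    rw [hw] at ht
    nlinarith
  obtain ⟨S, hS, hSt⟩ := exists_subset_card_eq hle
  have hfree := isSumFree_middlePreimage (k := j) (by omega) ψ
  exact ⟨S, fun x hx y hy z hz ↦ hfree x (hS hx) y (hS hy) z (hS hz), hSt⟩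

/-- For `k > 0` every subset of the fibre is sum-free, as `2k ≠ k` in `ℤ/p`. For `p = 2` the fibre
is the kernel, a group in its own right, and there the density `2 / 7` is needed. -/
lemma exists_isSumFree_subset_fibre {p k : ℕ} (hpk : p = 3 * k + 2) {G : Type u} [AddCommGroup G]
    [Fintype G] {φ : G →+ ZMod p} (hφ : Function.Surjective φ) {w : ℕ}
    (hw : Fintype.card G = p * w) {t : ℕ} (ht : 7 * t ≤ 2 * w) :
    ∃ A' : Finset G, A' ⊆ fibre k φ ∧ IsSumFree A' ∧ #A' = t := by
  classical
  have : NeZero p := ⟨by omega⟩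
  rcases Nat.eq_zero_or_pos k with rfl | hk
  · have hker : Fintype.card φ.ker = w := by
      rw [← card_filter_eq hφ hw 0, Fintype.card_subtype]
      congr 1
      ext x
      simp [AddMonoidHom.mem_ker]
    obtain ⟨S, hS, hSt⟩ := exists_isSumFree_card_eq φ.ker t (by rwa [hker])
    refine ⟨S.map ⟨Subtype.val, Subtype.val_injective⟩, fun x hx ↦ ?_, ?_, by rw [card_map, hSt]⟩
    · obtain ⟨y, _, rfl⟩ := mem_map.1 hx
      rw [mem_fibre, Nat.cast_zero]
      exact y.2
    · intro a ha b hb c hc habc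
      obtain ⟨x, hx, rfl⟩ := mem_map.1 ha
      obtain ⟨y, hy, rfl⟩ := mem_map.1 hb
      obtain ⟨z, hz, rfl⟩ := mem_map.1 hc
      exact hS x hx y hy z hz (Subtype.ext habc)
  · obtain ⟨S, hS, hSt⟩ := exists_subset_card_eq (s := fibre k φ) (n := t) (by
      rw [card_fibre hφ hw]
      omega)
    refine ⟨S, hS, fun x hx y hy z hz hxyz ↦ ?_, hSt⟩
    have h := congrArg φ hxyz
    rw [map_add, mem_fibre.1 (hS hx), mem_fibre.1 (hS hy), mem_fibre.1 (hS hz), add_eq_left,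
      ZMod.natCast_eq_zero_iff] at h
    exact absurd (Nat.le_of_dvd hk h) (by omega)

/-! ### From few Schur triples to the neighbourhood of an extremal set -/

/-- In a set `A` with `3 * #A ≥ |G| + w`, the elements in few Schur triples form a sum-free set. -/
lemma isSumFree_filter_card_lt {G : Type u} [AddCommGroup G] [Fintype G] [DecidableEq G]
    {A : Finset G} {w : ℕ} (hA : Fintype.card G + w ≤ 3 * #A) :
    IsSumFree (A.filter fun x ↦ 3 * #(A.filter fun y ↦ x + y ∈ A) < w) := by
  intro x hx y hy z hz hxyz
  rw [mem_filter] at hx hy hz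
  have hmem : ∀ g u : G, u ∈ g +ᵥ A ↔ u - g ∈ A := fun g u ↦ by
    rw [mem_vadd_finset]
    constructor
    · rintro ⟨a, ha, rfl⟩
      simpa using ha
    · exact fun h ↦ ⟨_, h, by simp⟩
  have hinter : ∀ g : G, #((g +ᵥ A) ∩ A) = #(A.filter fun a ↦ g + a ∈ A) := fun g ↦ by
    rw [← card_vadd_finset g (A.filter fun a ↦ g + a ∈ A)]
    congr 1
    ext u
    rw [mem_inter, hmem, mem_vadd_finset]
    constructor
    · exact fun h ↦ ⟨u - g, mem_filter.2 ⟨h.1, by simpa using h.2⟩, by simp⟩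
    · rintro ⟨a, ha, rfl⟩
      rw [mem_filter] at ha
      simpa using ha
  -- As `z = x + y`, this intersection is the translate by `y` of `A ∩ (x + A)`.
  have hyz : #((y +ᵥ A) ∩ (z +ᵥ A)) = #(A.filter fun a ↦ x + a ∈ A) := by
    rw [← hinter x, ← card_vadd_finset y ((x +ᵥ A) ∩ A), vadd_finset_inter, vadd_vadd, add_comm y,
      hxyz, inter_comm]
  have h1 := card_union_add_card_inter (y +ᵥ A) (z +ᵥ A)
  have h2 := card_union_add_card_inter ((y +ᵥ A) ∪ (z +ᵥ A)) A
  have h3 : #(((y +ᵥ A) ∪ (z +ᵥ A)) ∩ A) ≤ #((y +ᵥ A) ∩ A) + #((z +ᵥ A) ∩ A) := by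
    rw [union_inter_distrib_right]
    exact card_union_le _ _
  have h4 := card_le_univ (((y +ᵥ A) ∪ (z +ᵥ A)) ∪ A)
  rw [hinter, hinter] at h3
  rw [card_vadd_finset, card_vadd_finset, hyz] at h1
  omega

/-- Markov's inequality for the number of triples with given first entry. -/
lemma card_filter_not_mul_le {G : Type u} [AddCommGroup G] [DecidableEq G] (A : Finset G)
    (w : ℕ) :
    #(A.filter fun x ↦ ¬ 3 * #(A.filter fun y ↦ x + y ∈ A) < w) * w ≤ 3 * ST A := by
  rw [ST_eq_tripleCount, tripleCount_eq_sum_card, mul_sum, ← smul_eq_mul, ← sum_const]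
  calc _ ≤ ∑ x ∈ A.filter fun x ↦ ¬ 3 * #(A.filter fun y ↦ x + y ∈ A) < w,
        3 * #(A.filter fun y ↦ x + y ∈ A) :=
        sum_le_sum fun x hx ↦ not_lt.1 (mem_filter.1 hx).2
    _ ≤ _ := sum_le_sum_of_subset (filter_subset _ _)

lemma exists_prime_dvd_mod_three (m : ℕ) (hm : m % 3 = 2) :
    ∃ q, q.Prime ∧ q ∣ m ∧ q % 3 = 2 := by
  induction m using Nat.strong_induction_on with
  | _ m ih =>
  obtain ⟨q, hq, c, rfl⟩ := Nat.exists_prime_and_dvd (n := m) (by omega)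
  have hmod := Nat.mul_mod q c 3
  rw [hm] at hmod
  by_cases h2 : q % 3 = 2
  · exact ⟨q, hq, dvd_mul_right _ _, h2⟩
  · have hc : c % 3 = 2 := by
      rcases (show q % 3 = 0 ∨ q % 3 = 1 by omega) with h | h <;> rw [h] at hmod <;> omega
    obtain ⟨r, hr, hrc, hr3⟩ := ih c (by nlinarith [hq.two_le, show 0 < c by omega]) hc
    exact ⟨r, hr, hrc.mul_left q, hr3⟩

/-- A sum-free set `S` with `3 * #S` larger than, and close enough to `|G| + |G| / p`, lies in
some `φ⁻¹{j + 1, …, 2 j + 1}`. -/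
lemma IsSumFree.exists_subset_middlePreimage {p : ℕ} {G : Type u} [AddCommGroup G] [Fintype G]
    (hG : IsTypeI p G) {w : ℕ} (hw : Fintype.card G = p * w) {S : Finset G} (hS : IsSumFree S)
    {r : ℕ} (hcard : Fintype.card G + w ≤ 3 * #S + r) (hr : 2 * r < w) :
    ∃ q j : ℕ, q.Prime ∧ q = 3 * j + 2 ∧ p ≤ q ∧ ∃ φ : G →+ ZMod q, Function.Surjective φ ∧
      S ⊆ middlePreimage j φ ∧ ∃ h, Fintype.card G = q * h ∧ w ≤ h + r := by
  classical
  obtain ⟨Q, _, _, π, X, hπ, hX, hXc, hSX⟩ := hS.exists_quotient _ G S rfl (by omega)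
  obtain ⟨h, hh⟩ : ∃ h, h = #(univ.filter fun x : G ↦ π x = 0) := ⟨_, rfl⟩
  have hn := card_eq_card_mul_card_filter_zero hπ
  have hSh : #S ≤ #X * h := by
    rw [hh, ← card_filter_mem hπ]
    exact card_le_card fun s hs ↦ mem_filter.2 ⟨mem_univ _, hSX s hs⟩
  rw [← hh] at hn
  have hwh : w ≤ h + r := by
    have : 3 * #X * h = Fintype.card G + h := by
      rw [hXc, hn]
      ring
    nlinarith
  obtain ⟨q, hq, ⟨c, hc⟩, hq3⟩ := exists_prime_dvd_mod_three (Fintype.card Q) (by omega)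
  have hpq : p ≤ q := hG.2 ⟨hq, ⟨c * h, by rw [hn, hc, mul_assoc]⟩, hq3⟩
  have hp := hG.1.1.pos
  -- A proper multiple of `q` would make `|Q| ≥ 2p` and `w ≥ 2h`, contradicting `w ≤ h + r` and `2r
  -- < w`.
  have hQq : Fintype.card Q = q := by
    have hc2 : c < 2 := by
      by_contra! hc2
      have h1 : p * 2 ≤ Fintype.card Q := hc ▸ Nat.mul_le_mul hpq hc2
      have h2 := Nat.mul_le_mul_right h h1
      rw [← hn, hw, mul_assoc] at h2
      have := Nat.le_of_mul_le_mul_left h2 hp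
      omega
    have hc0 : c ≠ 0 := by
      rintro rfl
      have : 0 < Fintype.card Q := Fintype.card_pos
      omega
    obtain rfl : c = 1 := by omega
    rw [hc, mul_one]
  obtain ⟨χ, hχ⟩ := exists_surjective_zmod hq Q hQq.symm.dvd
  have : Fact q.Prime := ⟨hq⟩
  have hbij : Function.Bijective χ :=
    (Fintype.bijective_iff_surjective_and_card χ).2 ⟨hχ, by rw [hQq, ZMod.card]⟩
  obtain ⟨j, hj⟩ : ∃ j, q = 3 * j + 2 := ⟨q / 3, by omega⟩
  have hXχ : IsSumFree (X.image χ) := by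
    intro a ha b hb d hd habd
    obtain ⟨x, hx, rfl⟩ := mem_image.1 ha
    obtain ⟨y, hy, rfl⟩ := mem_image.1 hb
    obtain ⟨z, hz, rfl⟩ := mem_image.1 hd
    exact hX x hx y hy z hz (hbij.1 (by rw [map_add, habd]))
  obtain ⟨d, hd, hdX⟩ := hXχ.exists_dilate hj (k := j) (by
    rw [card_image_of_injective _ hbij.1]
    omega)
  refine ⟨q, j, hq, hj, hpq, (AddMonoidHom.mulLeft d).comp (χ.comp π), ?_, fun s hs ↦ ?_, h,
    by rw [hn, hQq], hwh⟩
  · exact (mul_left_surjective₀ hd).comp (hχ.comp hπ)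
  · rw [mem_middlePreimage]
    exact hdX _ (mem_image_of_mem _ (hSX s hs))

/-- The lower bound for the number of Schur triples in groups of type `I(p)`, and the structure of
the extremal sets. -/
theorem ST_ge_of_isTypeI {p k : ℕ} {G : Type u} [AddCommGroup G] [Fintype G] [DecidableEq G]
    (hG : IsTypeI p G) (hpk : p = 3 * k + 2) {w s : ℕ} (hw : Fintype.card G = p * w)
    (hs : 100 * s ≤ w) {A : Finset G} (hA : #A = (k + 1) * w + s) :
    3 * s * w + (if p ≠ 2 then 1 else 0) * s ^ 2 ≤ ST A ∧
    (ST A = 3 * s * w + (if p ≠ 2 then 1 else 0) * s ^ 2 →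
      ∃ ψ : G →+ ZMod p, Function.Surjective ψ ∧ ∃ A' : Finset G, A' ⊆ fibre k ψ ∧
        IsSumFree A' ∧ #A' = s ∧ A = middlePreimage k ψ ∪ A') := by
  rcases lt_or_ge (3 * s * w + (if p ≠ 2 then 1 else 0) * s ^ 2) (ST A) with hlt | hge
  · exact ⟨hlt.le, fun h ↦ absurd h hlt.ne'⟩
  have hp := hG.1.1.pos
  have hwpos : 0 < w := by
    have : 0 < Fintype.card G := Fintype.card_pos
    rw [hw] at this
    exact Nat.pos_of_mul_pos_left this
  have h3A : 3 * #A = Fintype.card G + w + 3 * s := by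
    rw [hA, hw, hpk]
    ring
  obtain ⟨S, hS⟩ : ∃ S, S = A.filter fun x ↦ 3 * #(A.filter fun y ↦ x + y ∈ A) < w := ⟨_, rfl⟩
  have hfree : IsSumFree S := by
    rw [hS]
    exact isSumFree_filter_card_lt (by omega)
  have hSA : #A ≤ #S + 12 * s := by
    have h1 := card_filter_not_mul_le A w
    have h2 := card_filter_add_card_filter_not (s := A)
      (fun x ↦ 3 * #(A.filter fun y ↦ x + y ∈ A) < w)
    rw [← hS] at h2
    have h3 : ST A ≤ 4 * s * w := by
      have : s * s ≤ s * w := Nat.mul_le_mul_left s (by omega)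
      split_ifs at hge <;> nlinarith
    have h4 := Nat.le_of_mul_le_mul_right (h1.trans (show _ ≤ (12 * s) * w by nlinarith)) hwpos
    omega
  -- `3 * #S ≥ 3 * #A - 36 * s = |G| + w - 33 * s`, whence `r = 33 * s`.
  obtain ⟨q, j, hq, hqj, hpq, φ, hφ, hSφ, h, hh, hwh⟩ :=
    hfree.exists_subset_middlePreimage hG hw (r := 33 * s) (by omega) (by omega)
  have hhw : h ≤ w := by
    rw [hw] at hh
    have := Nat.mul_le_mul_right h hpq
    rw [← hh] at this
    exact Nat.le_of_mul_le_mul_left this hp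
  have hA₀ := card_middlePreimage (by omega) hφ hh (k := j)
  have h3A₀ : 3 * ((j + 1) * h) = Fintype.card G + h := by
    rw [hh, hqj]
    ring
  obtain ⟨s', hs'⟩ : ∃ s', #A = (j + 1) * h + s' := Nat.exists_eq_add_of_le (by omega)
  have hM : #(middlePreimage j φ \ A) + #S ≤ (j + 1) * h := by
    rw [← hA₀, ← card_sdiff_add_card_eq_card hSφ]
    gcongr
    rw [hS]
    exact filter_subset _ _
  -- Here `3 * s' = 3 * s + (w - h)`, so the new excess and the missing part total at most `12 * s`.
  -- Closeness needs `48 * s ≤ h`, and `h ≥ w - 33 * s ≥ 67 * s`.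
  obtain ⟨hbound, hstruct⟩ := ST_ge_of_close hqj hφ hh A hs' (by omega)
  rcases hhw.eq_or_lt with rfl | hlt
  · obtain rfl : p = q := Nat.eq_of_mul_eq_mul_right hwpos (hw.symm.trans hh)
    obtain rfl : k = j := by omega
    obtain rfl : s' = s := by omega
    exact ⟨hbound, hstruct⟩
  · exfalso
    have hqp : q ≠ p := by
      rintro rfl
      have := Nat.eq_of_mul_eq_mul_left hp (hw.symm.trans hh)
      omega
    have hp2 := hG.1.1.two_le
    rw [if_pos (by omega)] at hbound
    have hss : s ^ 2 ≤ s' ^ 2 := Nat.pow_le_pow_left (by omega) 2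
    have h1 : (if p ≠ 2 then 1 else 0) * s ^ 2 ≤ s' ^ 2 := by
      split_ifs <;> omega
    -- The difference of the two sides is `(w - h) * (h - 3 * s)`, which is positive.
    have h2 : 3 * s * w < 3 * s' * h := by
      obtain ⟨d, rfl⟩ := Nat.exists_eq_add_of_lt hlt
      have : 3 * s' = 3 * s + (d + 1) := by omega
      rw [this]
      have : 3 * s * (d + 1) < (d + 1) * h := by
        rw [mul_comm]
        exact Nat.mul_lt_mul_of_pos_left (by omega) (by omega)
      nlinarith
    omega

end SchurTriples

/-! ### The main theorem -/

theorem theorem2 :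
    ∃ δ : ℝ, 0 < δ ∧
      ∀ (p k : ℕ) (G : Type u) [AddCommGroup G] [Fintype G] [DecidableEq G],
        SchurTriples.IsTypeI p G → p = 3 * k + 2 →
        -- the lower bound, and the structure of all sets that attain it
        (∀ t : ℝ, 0 ≤ t → t ≤ δ * (Fintype.card G : ℝ) / (p : ℝ) →
          ∀ A : Finset G,
            (A.card : ℝ) = (1 / 3 + 1 / (3 * (p : ℝ))) * (Fintype.card G : ℝ) + t →
            3 * t * (Fintype.card G : ℝ) / (p : ℝ) + (if p ≠ 2 then 1 else 0) * t ^ 2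
                ≤ (SchurTriples.ST A : ℝ) ∧
            ((SchurTriples.ST A : ℝ)
                = 3 * t * (Fintype.card G : ℝ) / (p : ℝ) + (if p ≠ 2 then 1 else 0) * t ^ 2 →
              ∃ φ : G →+ ZMod p, Function.Surjective φ ∧
                ∃ A' : Finset G, A' ⊆ SchurTriples.fibre k φ ∧ SchurTriples.IsSumFree A' ∧
                  (A'.card : ℝ) = t ∧ A = SchurTriples.middlePreimage k φ ∪ A')) ∧
        -- conversely, all sets of this form attain it, and they exist when `t ≤ 2|G|/(7p)`
        (∃ φ : G →+ ZMod p, Function.Surjective φ) ∧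
        (∀ φ : G →+ ZMod p, Function.Surjective φ →
          SchurTriples.IsSumFree (SchurTriples.middlePreimage k φ) ∧
          ((SchurTriples.middlePreimage k φ).card : ℝ)
            = (1 / 3 + 1 / (3 * (p : ℝ))) * (Fintype.card G : ℝ) ∧
          (∀ t : ℕ, (t : ℝ) ≤ 2 * (Fintype.card G : ℝ) / (7 * (p : ℝ)) →
            ∃ A' : Finset G, A' ⊆ SchurTriples.fibre k φ ∧ SchurTriples.IsSumFree A' ∧
              A'.card = t) ∧
          (∀ A' : Finset G, A' ⊆ SchurTriples.fibre k φ → SchurTriples.IsSumFree A' →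
            ((SchurTriples.middlePreimage k φ ∪ A').card : ℝ)
              = (1 / 3 + 1 / (3 * (p : ℝ))) * (Fintype.card G : ℝ) + (A'.card : ℝ) ∧
            (SchurTriples.ST (SchurTriples.middlePreimage k φ ∪ A') : ℝ)
              = 3 * (A'.card : ℝ) * (Fintype.card G : ℝ) / (p : ℝ)
                + (if p ≠ 2 then 1 else 0) * (A'.card : ℝ) ^ 2)) := by

  refine ⟨1 / 100, by norm_num, fun p k G _ _ _ hG hpk ↦ ?_⟩
  have hp := hG.1.1
  have hp0 : (p : ℝ) ≠ 0 := by exact_mod_cast hp.ne_zero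
  have : NeZero p := ⟨hp.ne_zero⟩
  obtain ⟨w, hw⟩ := hG.1.2.1
  have hpkR : (p : ℝ) = 3 * k + 2 := by exact_mod_cast hpk
  have hn : (Fintype.card G : ℝ) = p * w := by exact_mod_cast hw
  have hdens : (1 / 3 + 1 / (3 * (p : ℝ))) * (Fintype.card G : ℝ) = ((k + 1) * w : ℕ) := by
    rw [hn]
    field_simp
    push_cast
    rw [hpkR]
    ring
  have hrhs : ∀ s : ℕ, 3 * (s : ℝ) * (Fintype.card G : ℝ) / (p : ℝ) +
      (if p ≠ 2 then 1 else 0) * (s : ℝ) ^ 2 =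
        (3 * s * w + (if p ≠ 2 then 1 else 0) * s ^ 2 : ℕ) := fun s ↦ by
    rw [hn]
    push_cast
    field_simp
  refine ⟨fun t ht0 ht A hA ↦ ?_, SchurTriples.exists_surjective_zmod hp G hG.1.2.1,
    fun φ hφ ↦ ⟨SchurTriples.isSumFree_middlePreimage hpk.ge φ, ?_, fun t ht ↦ ?_,
      fun A' hA' hfree ↦ ⟨?_, ?_⟩⟩⟩
  · rw [hdens] at hA
    -- The real `t` is a difference of two natural numbers, hence itself a natural number `s`.
    obtain ⟨s, hs⟩ : ∃ s, A.card = (k + 1) * w + s := by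
      apply Nat.exists_eq_add_of_le
      have : (((k + 1) * w : ℕ) : ℝ) ≤ A.card := by linarith
      exact_mod_cast this
    obtain rfl : t = s := by
      rw [hs] at hA
      push_cast at hA
      linarith
    have hsw : 100 * s ≤ w := by
      rw [hn, ← mul_assoc, mul_comm _ (p : ℝ), mul_assoc, mul_div_cancel_left₀ _ hp0] at ht
      have : (100 * s : ℝ) ≤ w := by linarith
      exact_mod_cast this
    obtain ⟨h1, h2⟩ := SchurTriples.ST_ge_of_isTypeI hG hpk hw hsw hs
    rw [hrhs]
    refine ⟨by exact_mod_cast h1, fun heq ↦ ?_⟩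
    obtain ⟨ψ, hψ, A', hA', hfree, hcard, hAA⟩ := h2 (by exact_mod_cast heq)
    exact ⟨ψ, hψ, A', hA', hfree, by exact_mod_cast hcard, hAA⟩
  · rw [hdens, SchurTriples.card_middlePreimage (by omega) hφ hw]
  · apply SchurTriples.exists_isSumFree_subset_fibre hpk hφ hw
    rw [hn, le_div_iff₀ (by positivity)] at ht
    have hpos : (0 : ℝ) < p := by positivity
    have : (7 * t : ℝ) ≤ 2 * w := by
      apply le_of_mul_le_mul_left _ hpos
      linarith
    exact_mod_cast this
  · rw [hdens, Finset.card_union_of_disjoint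
      ((SchurTriples.disjoint_middlePreimage_fibre hpk φ).mono_right hA'),
      SchurTriples.card_middlePreimage (by omega) hφ hw]
    push_cast
    ring
  · rw [hrhs, SchurTriples.ST_middlePreimage_union hpk hφ hw hA', hfree.ST_eq_zero, add_zero]
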